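/- Let $n\ge 3$. Let $\mathcal M^-$ be the set of real $n\times n$ matrices $A$ whose diagonal entries are arbitrary reals $a_1,\dots,a_n$, whose entries $A_{i,i+1}=b_i$ and $A_{i+1,i}=c_i$ ($i=1,\dots,n$, indices modulo $n$, so $b_n=A_{n,1}$ and $c_n=A_{1,n}$) satisfy $b_ic_i\ge 0$ for all $i$ and $\prod_{i=1}^n b_i+\prod_{i=1}^n c_i\neq 0$, whose other entries are $0$, and for which either $b_1,\dots,b_{n-1}>0>b_n$ or $c_1,\dots,c_{n-1}>0>c_n$. For $x\in\mathbb R^n$ with all $x_j\ne0$ put $$N(x)=\#\{\,i\in\{1,\dots,n\} : \delta_i x_i x_{i+1}<0\,\},\qquad \delta_1=\dots=\delta_{n-1}=1,\ \delta_n=-1,\ x_{n+1}=x_1 .$$ For every $x\in\mathbb R^n$ let $N_m(x)$ and $N_M(x)$ be the minimum and the maximum of $N(y)$ over the vectors $y$ without zero coordinates in a sufficiently small neighbourhood of $x$. Let $\mathcal N=\{x: N_m(x)=N_M(x)\}$, and extend $N$ to $\mathcal N$ by $N(x)=N_m(x)=N_M(x)$. Let $\tilde n=n$ if $n$ is odd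 and $\tilde n=n-1$ if $n$ is even. **Theorem 3.1 (Floquet Theory).** Let $-\infty\le\alpha<\beta\le\infty$, let $A:(\alpha,\beta)\to\mathcal M^-$ be continuous, and let $s,t\in(\alpha,\beta)$ with $s<t$. Let $S=S_A(s,t)$ be the solution operator of $\dot x=A(\tau)x$ from time $s$ to time $t$, that is, the linear operator on $\mathbb R^n$ with $S\,x(s)=x(t)$ for every solution $x$ on $(\alpha,\beta)$. (Every initial value at time $s$ is taken by a solution on $(\alpha,\beta)$, so $S$ exists and is unique.) Then there are subspaces $W_1,\dots,W_{(\tilde n+1)/2}$ of $\mathbb R^n$, invariant under $S$, such that 1. $\dim W_i=2$ for $i=1,\dots,\frac{\tilde n-1}{2}$, and $\dim W_{(\tilde n+1)/2}$ is $1$ if $n$ is odd and $2$ if $n$ is even; 2. $\mathbb R^n=W_1\oplus\cdots\oplus W_{(\tilde n+1)/2}$; 3. if $x\in W_i\setminus\{0\}$, then $x\in\mathcal N$ and $N(x)=2i-1$; 4. if $i\le k$ and $0\ne x\in W_i\oplus W_{i+1}\oplus\cdots\oplus W_k$, then $N_m(x)\ge 2i-1$ and $N_M(x)\le 2k-1$;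 5. if $\nu_i$ and $\mu_i$ are the minimum and the maximum of the moduli of the (complex) characteristic values of the restriction of $S$ to $W_i$, then $$\mu_1\ge\nu_1>\mu_2\ge\nu_2>\cdots>\mu_{(\tilde n+1)/2}\ge\nu_{(\tilde n+1)/2}.$$ -/

import Mathlib

open Set Filter Topology

noncomputable section

/-- The cyclic tridiagonal matrix with diagonal `a`, entries `b i` in position `(i, i + 1)` and
entries `c i` in position `(i + 1, i)`, indices being cyclic (`finRotate n i` is the cyclic
successor of `i`, so the last `b` is the lower left and the last `c` the upper right corner). For
`3 ≤ n` these positions are pairwise different. -/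
def cyclicTridiagonal {n : ℕ} (a b c : Fin n → ℝ) : Matrix (Fin n) (Fin n) ℝ :=
  Matrix.of fun i j =>
    if j = i then a i
    else if j = finRotate n i then b i
    else if i = finRotate n j then c j
    else 0

/-- All entries are positive, except the last one, which is negative. -/
def NegativeFeedbackSigns {n : ℕ} (b : Fin n → ℝ) : Prop :=
  ∀ i : Fin n, if (i : ℕ) + 1 = n then b i < 0 else 0 < b i

/-- The class `M⁻` of matrices of linear bidirectional cyclic negative feedback systems. -/
def MMinus (n : ℕ) : Set (Matrix (Fin n) (Fin n) ℝ) :=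
  {A | ∃ a b c : Fin n → ℝ, A = cyclicTridiagonal a b c ∧
    (∀ i, 0 ≤ b i * c i) ∧ (∏ i, b i) + (∏ i, c i) ≠ 0 ∧
    (NegativeFeedbackSigns b ∨ NegativeFeedbackSigns c)}

/-- The open interval `(α, β)` of real numbers, possibly unbounded. -/
def realIoo (α β : EReal) : Set ℝ :=
  {τ : ℝ | α < (τ : EReal) ∧ (τ : EReal) < β}

/-- `x` solves `x' = A(τ) x` on the interval `(α, β)`. -/
def IsLinearSolution {n : ℕ} (α β : EReal) (A : ℝ → Matrix (Fin n) (Fin n) ℝ)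
    (x : ℝ → Fin n → ℝ) : Prop :=
  ∀ τ ∈ realIoo α β, HasDerivAt x ((A τ).mulVec (x τ)) τ

/-- `S` is the solution operator from time `s` to time `t` of `x' = A(τ) x` on `(α, β)`: every
initial value at time `s` is taken by a solution on the whole of `(α, β)`, and `S` maps the value
at time `s` of any solution to its value at time `t`. -/
structure IsSolutionOperator {n : ℕ} (α β : EReal) (A : ℝ → Matrix (Fin n) (Fin n) ℝ)
    (s t : ℝ) (S : (Fin n → ℝ) →ₗ[ℝ] (Fin n → ℝ)) : Prop where
  exists_solution : ∀ x₀ : Fin n → ℝ, ∃ x, IsLinearSolution α β A x ∧ x s = x₀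
  map_solution : ∀ x, IsLinearSolution α β A x → S (x s) = x t

/-- There is at most one solution operator. -/
theorem IsSolutionOperator.unique {n : ℕ} {α β : EReal} {A : ℝ → Matrix (Fin n) (Fin n) ℝ}
    {s t : ℝ} {S S' : (Fin n → ℝ) →ₗ[ℝ] (Fin n → ℝ)}
    (h : IsSolutionOperator α β A s t S) (h' : IsSolutionOperator α β A s t S') : S = S' := by
  ext1 i
  ext1
  obtain ⟨x, hx, hx0⟩ := h.exists_solution (LinearMap.single ℝ (fun _ : Fin n => ℝ) i 1)
  rw [LinearMap.comp_apply, LinearMap.comp_apply, ← hx0, h.map_solution x hx, h'.map_solution x hx]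

/-- The signs `δ i`: `-1` for the edge joining the last index to the first one, `1` otherwise. -/
def edgeSign {n : ℕ} (i : Fin n) : ℝ := if (i : ℕ) + 1 = n then -1 else 1

/-- The vectors without zero coordinates. -/
def nonvanishing (n : ℕ) : Set (Fin n → ℝ) := {x | ∀ j, x j ≠ 0}

/-- The number of cyclic sign changes of `x` relative to the signs `δ`. It is the integer-valued
Lyapunov function on vectors without zero coordinates. -/
def signChanges {n : ℕ} (x : Fin n → ℝ) : ℕ :=
  {i : Fin n | edgeSign i * x i * x (finRotate n i) < 0}.ncard

/-- The values that `signChanges` takes on vectors without zero coordinates in every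
neighbourhood of `x`; equivalently, those it takes in a sufficiently small one. -/
def nearbyValues {n : ℕ} (x : Fin n → ℝ) : Set ℕ :=
  {k | ∃ᶠ y in 𝓝[nonvanishing n] x, signChanges y = k}

/-- `N_m x`, the minimum of `N` near `x`. -/
def lyapMin {n : ℕ} (x : Fin n → ℝ) : ℕ := sInf (nearbyValues x)

/-- `N_M x`, the maximum of `N` near `x`. -/
def lyapMax {n : ℕ} (x : Fin n → ℝ) : ℕ := sSup (nearbyValues x)

/-- The set `𝒩` of vectors `x` with `N_m x = N_M x`. -/
def lyapDomain (n : ℕ) : Set (Fin n → ℝ) := {x | lyapMin x = lyapMax x}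

/-- The extension of `N` to `𝒩`, the common value of `N_m` and `N_M` (used on `𝒩` only). -/
def lyapN {n : ℕ} (x : Fin n → ℝ) : ℕ := lyapMin x

theorem nearbyValues_of_nonvanishing {n : ℕ} {x : Fin n → ℝ} (hx : x ∈ nonvanishing n) :
    nearbyValues x = {signChanges x} := by
  have h : ∀ᶠ y in 𝓝 x, signChanges y = signChanges x := by
    have h1 : ∀ᶠ y in 𝓝 x, ∀ i : Fin n, (edgeSign i * y i * y (finRotate n i) < 0 ↔
        edgeSign i * x i * x (finRotate n i) < 0) := by
      refine eventually_all.2 fun i => ?_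
      have hc : Continuous fun y : Fin n → ℝ => edgeSign i * y i * y (finRotate n i) := by
        fun_prop
      have hne : edgeSign i * x i * x (finRotate n i) ≠ 0 := by
        refine mul_ne_zero (mul_ne_zero ?_ (hx _)) (hx _)
        unfold edgeSign
        split_ifs <;> norm_num
      rcases lt_or_gt_of_ne hne with h | h
      · filter_upwards [hc.continuousAt.eventually_lt_const h] with y hy
        exact iff_of_true hy h
      · filter_upwards [hc.continuousAt.eventually_const_lt h] with y hy
        exact iff_of_false hy.le.not_gt h.le.not_gt
    filter_upwards [h1] with y hy
    simp only [signChanges, hy]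
  have hne : (𝓝[nonvanishing n] x).NeBot := mem_closure_iff_nhdsWithin_neBot.1 (subset_closure hx)
  have h' : ∀ᶠ y in 𝓝[nonvanishing n] x, signChanges y = signChanges x :=
    h.filter_mono nhdsWithin_le_nhds
  ext k
  simp only [nearbyValues, mem_ofPred_eq, mem_singleton_iff]
  constructor
  · intro hk
    obtain ⟨y, hy, hy'⟩ := (hk.and_eventually h').exists
    exact hy.symm.trans hy'
  · rintro rfl
    exact h'.frequently

/-- On vectors without zero coordinates, `lyapN` is the number of sign changes. -/
theorem lyapN_of_nonvanishing {n : ℕ} {x : Fin n → ℝ} (hx : x ∈ nonvanishing n) :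
    x ∈ lyapDomain n ∧ lyapN x = signChanges x := by
  simp [lyapDomain, lyapN, lyapMin, lyapMax, nearbyValues_of_nonvanishing hx]

/-- `ñ`: the largest odd number that is at most `n` (for `1 ≤ n`). -/
def oddFloor (n : ℕ) : ℕ := if Odd n then n else n - 1

/-- The moduli of the characteristic values of a real linear operator, that is, of the complex
roots of its characteristic polynomial. -/
def spectralModuli {V : Type*} [AddCommGroup V] [Module ℝ V] [Module.Finite ℝ V]
    (T : V →ₗ[ℝ] V) : Set ℝ :=
  {r | ∃ z : ℂ, (T.charpoly.map (algebraMap ℝ ℂ)).IsRoot z ∧ ‖z‖ = r}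

end

/-! Everything rests on one inequality: `lyapMax (S v) ≤ lyapMin v` for `v ≠ 0`
(`lyapMax_le_lyapMin_of_isSolutionOperator`). The rest is linear algebra using only this, the
semicontinuity and scaling invariance of `lyapMin` and `lyapMax`, and the bounds on dimensions
below.

Monotonicity. The closed cone `N_m ≤ c` is preserved by elementary matrices whose off-diagonal entry
joins cyclic neighbours and has the sign `δ`, since a coordinate then changes sign only next to an
existing sign change. To first order, a step along a system in `M⁻` is a product of such matrices,
so the field is subtangential to the cone, and Grönwall's inequality for the distance to the cone
shows that solutions do not leave it. Strictness. On some subinterval of any time interval each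
coordinate vanishes identically or nowhere. There the equation puts every zero between neighbours of
opposite signed signs, so the solution lies in `𝒩` at that time. Vectors close to the final value
come from vectors close to this intermediate one, which bounds `N_M` at the end by `N` there.

Linear algebra. Let `E_r` consist of the real sums of complex eigenvectors to eigenvalues of modulus
`r`. Its vectors are recurrent under `r⁻ᵏ Sᵏ`, so the chain of inequalities along an orbit collapses
to `N_m = N_M`; by connectedness `N` is constant on `E_r` without zero. Comparing `Sᵏ (x + y)` as `k
→ ∞` and as `k → -∞` shows that `N` does not increase with `r`. The space `W_i` collects the
generalized eigenspaces of the eigenvalues whose modulus carries the same odd value of `N`; this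
grouping makes the moduli strictly ordered. Normalized forward iterates of an arbitrary vector
accumulate at a nonzero vector of some `E_r`, which bounds `N_m` from below; backward iterates bound
`N_M` from above.

Dimensions. A vector in `𝒩` has no two adjacent zeros, and none at all if `N = n`. Hence two
adjacent coordinates, or one, determine a vector of `W_i`. As the values are odd and at most `n`,
the `W_i` exhaust the space; the bounds on the dimensions add up to `n`, so all are equalities. -/

/-! ### Sign changes -/

/-- The signed product of the two coordinates that are joined by an edge. -/
def edgeValue {n : ℕ} (x : Fin n → ℝ) (i : Fin n) : ℝ :=
  edgeSign i * x i * x (finRotate n i)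

theorem edgeSign_mul_self {n : ℕ} (i : Fin n) : edgeSign i * edgeSign i = 1 := by
  unfold edgeSign
  split_ifs <;> norm_num

theorem edgeSign_ne_zero {n : ℕ} (i : Fin n) : edgeSign i ≠ 0 := by
  unfold edgeSign
  split_ifs <;> norm_num

theorem edgeValue_ne_zero {n : ℕ} {x : Fin n → ℝ} (hx : x ∈ nonvanishing n) (i : Fin n) :
    edgeValue x i ≠ 0 :=
  mul_ne_zero (mul_ne_zero (edgeSign_ne_zero i) (hx _)) (hx _)

theorem continuous_edgeValue {n : ℕ} (i : Fin n) :
    Continuous fun x : Fin n → ℝ => edgeValue x i := by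
  unfold edgeValue
  fun_prop

theorem signChanges_eq_card {n : ℕ} (x : Fin n → ℝ) :
    signChanges x = (Finset.univ.filter fun i => edgeValue x i < 0).card := by
  rw [← Set.ncard_coe_finset]
  simp [signChanges, edgeValue]

theorem signChanges_eq_sum {n : ℕ} (x : Fin n → ℝ) :
    signChanges x = ∑ i, if edgeValue x i < 0 then 1 else 0 := by
  rw [signChanges_eq_card, Finset.card_filter]

theorem signChanges_le {n : ℕ} (x : Fin n → ℝ) : signChanges x ≤ n := by
  rw [signChanges_eq_card]
  exact (Finset.card_le_univ _).trans (by simp)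

theorem signChanges_congr {n : ℕ} {x y : Fin n → ℝ} (h : ∀ i, 0 < x i * y i) :
    signChanges x = signChanges y := by
  have key : ∀ i, edgeValue x i < 0 ↔ edgeValue y i < 0 := by
    intro i
    have h2 : 0 < edgeValue x i * edgeValue y i := by
      have : edgeValue x i * edgeValue y i =
          (edgeSign i * edgeSign i) * (x i * y i) * (x (finRotate n i) * y (finRotate n i)) := by
        unfold edgeValue
        ring
      rw [this, edgeSign_mul_self, one_mul]
      exact mul_pos (h _) (h _)
    rcases pos_and_pos_or_neg_and_neg_of_mul_pos h2 with h3 | h3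
    · exact iff_of_false h3.1.le.not_gt h3.2.le.not_gt
    · exact iff_of_true h3.1 h3.2
  rw [signChanges_eq_sum, signChanges_eq_sum]
  simp only [key]

theorem val_finRotate {n : ℕ} (i : Fin n) :
    (finRotate n i : ℕ) = if (i : ℕ) + 1 = n then 0 else (i : ℕ) + 1 := by
  obtain ⟨m, rfl⟩ : ∃ m, n = m + 1 := ⟨n - 1, by have := i.isLt; omega⟩
  rw [coe_finRotate]
  simp only [Fin.ext_iff, Fin.val_last, Nat.add_right_cancel_iff]

theorem finRotate_ne_self {n : ℕ} (hn : 2 ≤ n) (i : Fin n) : finRotate n i ≠ i := by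
  intro h
  have h1 := congrArg Fin.val h
  rw [val_finRotate] at h1
  split_ifs at h1 with h2 <;> omega

theorem finRotate_finRotate_ne_self {n : ℕ} (hn : 3 ≤ n) (i : Fin n) :
    finRotate n (finRotate n i) ≠ i := by
  intro h
  have h1 := congrArg Fin.val h
  have h2 := val_finRotate i
  rw [val_finRotate] at h1
  split_ifs at h1 h2 <;> omega

theorem finRotate_symm_ne_self {n : ℕ} (hn : 2 ≤ n) (i : Fin n) : (finRotate n).symm i ≠ i := by
  intro h
  exact finRotate_ne_self hn i (by rw [Equiv.symm_apply_eq] at h; exact h.symm)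

/-- The vector with the sign of one coordinate changed. -/
def flipSign {n : ℕ} (i : Fin n) (x : Fin n → ℝ) : Fin n → ℝ :=
  Function.update x i (-x i)

theorem flipSign_mem {n : ℕ} (i : Fin n) {x : Fin n → ℝ} (hx : x ∈ nonvanishing n) :
    flipSign i x ∈ nonvanishing n := by
  intro j
  unfold flipSign
  rcases eq_or_ne j i with rfl | h
  · simpa using hx j
  · simpa [h] using hx j

theorem edgeValue_flipSign_self {n : ℕ} (hn : 2 ≤ n) (i : Fin n) (x : Fin n → ℝ) :
    edgeValue (flipSign i x) i = -edgeValue x i := by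
  simp [edgeValue, flipSign, finRotate_ne_self hn i, -finRotate_apply]

theorem edgeValue_flipSign_pred {n : ℕ} (hn : 2 ≤ n) (i : Fin n) (x : Fin n → ℝ) :
    edgeValue (flipSign i x) ((finRotate n).symm i) = -edgeValue x ((finRotate n).symm i) := by
  simp [edgeValue, flipSign, finRotate_symm_ne_self hn i, -finRotate_symm_apply]

theorem edgeValue_flipSign_of_ne {n : ℕ} {i j : Fin n} (h : j ≠ i)
    (h' : j ≠ (finRotate n).symm i) (x : Fin n → ℝ) :
    edgeValue (flipSign i x) j = edgeValue x j := by
  have : finRotate n j ≠ i := fun h2 => h' (by rw [← h2, Equiv.symm_apply_apply])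
  simp only [edgeValue, flipSign, Function.update_of_ne h, Function.update_of_ne this]

/-- Only the two edges at `i` reverse, and each contribution `e` becomes `1 - e`. The additive form
avoids subtraction in `ℕ`. -/
theorem signChanges_flipSign {n : ℕ} (hn : 2 ≤ n) (i : Fin n) {x : Fin n → ℝ}
    (hx : x ∈ nonvanishing n) :
    signChanges (flipSign i x) + 2 * ((if edgeValue x i < 0 then 1 else 0) +
      if edgeValue x ((finRotate n).symm i) < 0 then 1 else 0) = signChanges x + 2 := by
  have hne := finRotate_symm_ne_self hn i
  have split : ∀ y : Fin n → ℝ, signChanges y =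
      (if edgeValue y i < 0 then 1 else 0) +
        ((if edgeValue y ((finRotate n).symm i) < 0 then 1 else 0) +
        ∑ j ∈ (Finset.univ.erase i).erase ((finRotate n).symm i),
          if edgeValue y j < 0 then 1 else 0) := by
    intro y
    rw [signChanges_eq_sum, ← Finset.add_sum_erase _ _ (Finset.mem_univ i),
      ← Finset.add_sum_erase _ _ (Finset.mem_erase.2 ⟨hne, Finset.mem_univ _⟩)]
  have rest : ∑ j ∈ (Finset.univ.erase i).erase ((finRotate n).symm i),
      (if edgeValue (flipSign i x) j < 0 then 1 else 0) =
      ∑ j ∈ (Finset.univ.erase i).erase ((finRotate n).symm i),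
      (if edgeValue x j < 0 then 1 else 0) := by
    refine Finset.sum_congr rfl fun j hj => ?_
    rw [Finset.mem_erase, Finset.mem_erase] at hj
    rw [edgeValue_flipSign_of_ne hj.2.1 hj.1]
  rw [split, split x, rest, edgeValue_flipSign_self hn, edgeValue_flipSign_pred hn]
  have h1 := edgeValue_ne_zero hx i
  have h2 := edgeValue_ne_zero hx ((finRotate n).symm i)
  have c1 : (if -edgeValue x i < 0 then 1 else 0) + (if edgeValue x i < 0 then 1 else 0) = 1 := by
    rcases lt_or_gt_of_ne h1 with h | h
    · simp [h, h.le]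
    · simp [h, h.le]
  have c2 : (if -edgeValue x ((finRotate n).symm i) < 0 then 1 else 0) +
      (if edgeValue x ((finRotate n).symm i) < 0 then 1 else 0) = 1 := by
    rcases lt_or_gt_of_ne h2 with h | h
    · simp [h, h.le, -finRotate_symm_apply]
    · simp [h, h.le, -finRotate_symm_apply]
  omega

/-- Changing one coordinate does not create sign changes, if it keeps its sign or is next to a
sign change. -/
theorem signChanges_update_le {n : ℕ} (hn : 2 ≤ n) {i : Fin n} {x : Fin n → ℝ}
    (hx : x ∈ nonvanishing n) {v : ℝ} (hv : v ≠ 0)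
    (h : v * x i < 0 → edgeValue x i < 0 ∨ edgeValue x ((finRotate n).symm i) < 0) :
    signChanges (Function.update x i v) ≤ signChanges x := by
  rcases lt_or_gt_of_ne (mul_ne_zero hv (hx i)) with h1 | h1
  · have e : signChanges (Function.update x i v) = signChanges (flipSign i x) := by
      refine signChanges_congr fun j => ?_
      unfold flipSign
      rcases eq_or_ne j i with rfl | hj
      · simpa using h1
      · simpa [hj] using mul_self_pos.2 (hx j)
    have := signChanges_flipSign hn i hx
    rw [e]
    rcases h h1 with h2 | h2
    · rw [if_pos h2] at this
      omega
    · rw [if_pos h2] at this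
      omega
  · refine le_of_eq (signChanges_congr fun j => ?_)
    rcases eq_or_ne j i with rfl | hj
    · simpa using h1
    · simpa [hj] using mul_self_pos.2 (hx j)

theorem prod_edgeSign {n : ℕ} (hn : 1 ≤ n) : ∏ i : Fin n, edgeSign i = -1 := by
  obtain ⟨m, rfl⟩ : ∃ m, n = m + 1 := ⟨n - 1, by omega⟩
  rw [Fin.prod_univ_castSucc]
  have h1 : ∀ i : Fin m, edgeSign i.castSucc = 1 := by
    intro i
    unfold edgeSign
    rw [if_neg]
    simp
    omega
  simp only [h1, Finset.prod_const_one, one_mul]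
  simp [edgeSign]

/-- Every coordinate enters two edges and the product of the `δ i` is `-1`, so the product of the
edge values is minus a square. -/
theorem odd_signChanges {n : ℕ} (hn : 1 ≤ n) {x : Fin n → ℝ} (hx : x ∈ nonvanishing n) :
    Odd (signChanges x) := by
  have h1 : ∏ i, edgeValue x i < 0 := by
    have : ∏ i, edgeValue x i = -(∏ i, x i) ^ 2 := by
      unfold edgeValue
      rw [Finset.prod_mul_distrib, Finset.prod_mul_distrib, prod_edgeSign hn,
        Equiv.prod_comp (finRotate n) x]
      ring
    rw [this]
    have : ∏ i, x i ≠ 0 := Finset.prod_ne_zero_iff.2 fun i _ => hx i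
    have := sq_pos_of_ne_zero this
    linarith
  have h2 : ∏ i, edgeValue x i = (-1) ^ signChanges x * ∏ i, |edgeValue x i| := by
    have : ∀ i, edgeValue x i = (if edgeValue x i < 0 then -1 else 1) * |edgeValue x i| := by
      intro i
      split_ifs with h
      · rw [abs_of_neg h]
        ring
      · rw [abs_of_nonneg (not_lt.1 h), one_mul]
    rw [Finset.prod_congr rfl fun i _ => this i, Finset.prod_mul_distrib, Finset.prod_ite,
      Finset.prod_const, Finset.prod_const_one, mul_one, signChanges_eq_card]
  by_contra h
  rw [Nat.not_odd_iff_even] at h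
  rw [h2, h.neg_one_pow, one_mul] at h1
  exact h1.not_ge (Finset.prod_nonneg fun i _ => abs_nonneg _)

/-! ### Values near a vector -/

theorem nonvanishing_eq_pi (n : ℕ) : nonvanishing n = univ.pi fun _ => ({0}ᶜ : Set ℝ) := by
  ext x
  simp [nonvanishing]

theorem dense_nonvanishing (n : ℕ) : Dense (nonvanishing n) := by
  rw [nonvanishing_eq_pi]
  exact dense_pi _ fun _ _ => dense_compl_singleton 0

instance nhdsWithin_nonvanishing_neBot {n : ℕ} (x : Fin n → ℝ) : (𝓝[nonvanishing n] x).NeBot :=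
  mem_closure_iff_nhdsWithin_neBot.1 (dense_nonvanishing n x)

theorem le_of_mem_nearbyValues {n : ℕ} {x : Fin n → ℝ} {k : ℕ} (h : k ∈ nearbyValues x) :
    k ≤ n := by
  obtain ⟨y, rfl⟩ := h.exists
  exact signChanges_le y

theorem odd_of_mem_nearbyValues {n : ℕ} (hn : 1 ≤ n) {x : Fin n → ℝ} {k : ℕ}
    (h : k ∈ nearbyValues x) : Odd k := by
  obtain ⟨y, rfl, hy⟩ := (h.and_eventually eventually_mem_nhdsWithin).exists
  exact odd_signChanges hn hy

/-- Only finitely many values are possible, so those that do not recur near `x` can be excluded by a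
single neighbourhood. This is the "sufficiently small neighbourhood" in the definition of `N_m` and
`N_M`. -/
theorem eventually_mem_nearbyValues {n : ℕ} (x : Fin n → ℝ) :
    ∀ᶠ y in 𝓝[nonvanishing n] x, signChanges y ∈ nearbyValues x := by
  have h : ∀ᶠ y in 𝓝[nonvanishing n] x, ∀ k ∈ Iic n, k ∉ nearbyValues x → signChanges y ≠ k := by
    refine (eventually_all_finite (finite_Iic n)).2 fun k _ => ?_
    by_cases hk : k ∈ nearbyValues x
    · exact Eventually.of_forall fun y h => absurd hk h
    · filter_upwards [not_frequently.1 hk] with y hy _ using hy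
  filter_upwards [h] with y hy
  by_contra h2
  exact hy _ (signChanges_le y) h2 rfl

theorem nearbyValues_nonempty {n : ℕ} (x : Fin n → ℝ) : (nearbyValues x).Nonempty :=
  let ⟨_, hy⟩ := (eventually_mem_nearbyValues x).exists
  ⟨_, hy⟩

theorem bddAbove_nearbyValues {n : ℕ} (x : Fin n → ℝ) : BddAbove (nearbyValues x) :=
  ⟨n, fun _ => le_of_mem_nearbyValues⟩

theorem lyapMin_mem {n : ℕ} (x : Fin n → ℝ) : lyapMin x ∈ nearbyValues x :=
  Nat.sInf_mem (nearbyValues_nonempty x)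

theorem lyapMax_mem {n : ℕ} (x : Fin n → ℝ) : lyapMax x ∈ nearbyValues x :=
  Nat.sSup_mem (nearbyValues_nonempty x) (bddAbove_nearbyValues x)

theorem lyapMin_le_of_mem {n : ℕ} {x : Fin n → ℝ} {k : ℕ} (h : k ∈ nearbyValues x) :
    lyapMin x ≤ k :=
  Nat.sInf_le h

theorem le_lyapMax_of_mem {n : ℕ} {x : Fin n → ℝ} {k : ℕ} (h : k ∈ nearbyValues x) :
    k ≤ lyapMax x :=
  le_csSup (bddAbove_nearbyValues x) h

theorem lyapMin_le_lyapMax {n : ℕ} (x : Fin n → ℝ) : lyapMin x ≤ lyapMax x :=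
  lyapMin_le_of_mem (lyapMax_mem x)

theorem lyapMin_of_nonvanishing {n : ℕ} {x : Fin n → ℝ} (hx : x ∈ nonvanishing n) :
    lyapMin x = signChanges x := by
  simp [lyapMin, nearbyValues_of_nonvanishing hx]

/-- Source of both semicontinuities: a small neighbourhood of `x` is also a neighbourhood of each
point near `x`. -/
theorem eventually_nearbyValues_subset {n : ℕ} (x : Fin n → ℝ) :
    ∀ᶠ y in 𝓝 x, nearbyValues y ⊆ nearbyValues x := by
  have h' : ∀ᶠ y in 𝓝 x, ∀ᶠ z in 𝓝[nonvanishing n] y, signChanges z ∈ nearbyValues x := by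
    have := eventually_mem_nearbyValues x
    rw [eventually_nhdsWithin_iff] at this
    filter_upwards [eventually_eventually_nhds.2 this] with y hy
    exact eventually_nhdsWithin_iff.2 hy
  filter_upwards [h'] with y hy k hk
  obtain ⟨z, rfl, hz⟩ := (Frequently.and_eventually hk hy).exists
  exact hz

theorem eventually_lyapMin_le {n : ℕ} (x : Fin n → ℝ) : ∀ᶠ y in 𝓝 x, lyapMin x ≤ lyapMin y := by
  filter_upwards [eventually_nearbyValues_subset x] with y hy
  exact lyapMin_le_of_mem (hy (lyapMin_mem y))

theorem eventually_lyapMax_le {n : ℕ} (x : Fin n → ℝ) : ∀ᶠ y in 𝓝 x, lyapMax y ≤ lyapMax x := by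
  filter_upwards [eventually_nearbyValues_subset x] with y hy
  exact le_lyapMax_of_mem (hy (lyapMax_mem y))

theorem eventually_signChanges_eq {n : ℕ} {x : Fin n → ℝ} (hx : x ∈ lyapDomain n) :
    ∀ᶠ y in 𝓝[nonvanishing n] x, signChanges y = lyapMin x := by
  filter_upwards [eventually_mem_nearbyValues x] with y hy
  exact le_antisymm ((le_lyapMax_of_mem hy).trans (le_of_eq hx.symm)) (lyapMin_le_of_mem hy)

theorem mem_lyapDomain_of_eventually {n : ℕ} {x : Fin n → ℝ} {c : ℕ}
    (h : ∀ᶠ y in 𝓝[nonvanishing n] x, signChanges y = c) : x ∈ lyapDomain n := by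
  have key : ∀ k ∈ nearbyValues x, k = c := by
    intro k hk
    obtain ⟨y, rfl, hy⟩ := (Frequently.and_eventually hk h).exists
    exact hy
  exact (key _ (lyapMin_mem x)).trans (key _ (lyapMax_mem x)).symm

theorem nearbyValues_smul_subset {n : ℕ} {a : ℝ} (ha : a ≠ 0) (x : Fin n → ℝ) :
    nearbyValues x ⊆ nearbyValues (a • x) := by
  intro k hk
  have hmap : Tendsto (fun y : Fin n → ℝ => a • y) (𝓝[nonvanishing n] x)
      (𝓝[nonvanishing n] (a • x)) := by
    refine tendsto_nhdsWithin_of_tendsto_nhds_of_eventually_within _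
      (((continuous_const_smul a).tendsto x).mono_left nhdsWithin_le_nhds) ?_
    filter_upwards [self_mem_nhdsWithin] with y hy j
    exact mul_ne_zero ha (hy j)
  refine hmap.frequently (Frequently.mono hk fun y hy => ?_)
  rw [← hy, signChanges_eq_sum, signChanges_eq_sum]
  refine Finset.sum_congr rfl fun i _ => ?_
  have : edgeValue (a • y) i = (a * a) * edgeValue y i := by
    simp only [edgeValue, Pi.smul_apply, smul_eq_mul]
    ring
  simp only [this, mul_neg_iff, mul_self_pos.2 ha, (mul_self_pos.2 ha).le.not_gt, true_and,
    false_and, or_false]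

theorem nearbyValues_smul {n : ℕ} {a : ℝ} (ha : a ≠ 0) (x : Fin n → ℝ) :
    nearbyValues (a • x) = nearbyValues x := by
  refine (nearbyValues_smul_subset ha x).antisymm' ?_
  have := nearbyValues_smul_subset (inv_ne_zero ha) (a • x)
  rwa [inv_smul_smul₀ ha] at this

theorem lyapMin_smul {n : ℕ} {a : ℝ} (ha : a ≠ 0) (x : Fin n → ℝ) :
    lyapMin (a • x) = lyapMin x := by
  rw [lyapMin, nearbyValues_smul ha, lyapMin]

theorem lyapMax_smul {n : ℕ} {a : ℝ} (ha : a ≠ 0) (x : Fin n → ℝ) :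
    lyapMax (a • x) = lyapMax x := by
  rw [lyapMax, nearbyValues_smul ha, lyapMax]

/-! ### Zeros of vectors in the domain of the Lyapunov function -/

/-- At a zero coordinate the reflection fixes `x`, so whatever holds for all nonvanishing vectors
near `x` also holds for their reflections. -/
theorem tendsto_flipSign {n : ℕ} {i : Fin n} {x : Fin n → ℝ} (hx : x i = 0) :
    Tendsto (flipSign i) (𝓝[nonvanishing n] x) (𝓝[nonvanishing n] x) := by
  have hc : Continuous (flipSign i : (Fin n → ℝ) → Fin n → ℝ) := by
    unfold flipSign
    exact continuous_id.update i (continuous_apply i).neg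
  have hfix : flipSign i x = x := by
    unfold flipSign
    rw [hx, neg_zero, ← hx, Function.update_eq_self]
  refine tendsto_nhdsWithin_of_tendsto_nhds_of_eventually_within _ ?_ ?_
  · have := hc.tendsto x
    rw [hfix] at this
    exact this.mono_left nhdsWithin_le_nhds
  · filter_upwards [self_mem_nhdsWithin] with y hy using flipSign_mem i hy

/-- In the domain of the Lyapunov function, the two edges at a zero have opposite signs nearby. -/
theorem eventually_edgeValue_opposite {n : ℕ} (hn : 2 ≤ n) {i : Fin n} {x : Fin n → ℝ}
    (hx : x ∈ lyapDomain n) (hi : x i = 0) : ∀ᶠ y in 𝓝[nonvanishing n] x,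
      edgeValue y i * edgeValue y ((finRotate n).symm i) < 0 := by
  have h1 := eventually_signChanges_eq hx
  filter_upwards [h1, (tendsto_flipSign hi).eventually h1, self_mem_nhdsWithin] with y hy hy' hnv
  have h2 := signChanges_flipSign hn i hnv
  rw [hy, hy'] at h2
  have h3 := edgeValue_ne_zero hnv i
  have h4 := edgeValue_ne_zero hnv ((finRotate n).symm i)
  rcases lt_or_gt_of_ne h3 with h5 | h5 <;> rcases lt_or_gt_of_ne h4 with h6 | h6
  · simp [h5, h6, -finRotate_symm_apply] at h2
  · exact mul_neg_of_neg_of_pos h5 h6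
  · exact mul_neg_of_pos_of_neg h5 h6
  · simp [h5.le.not_gt, h6.le.not_gt, -finRotate_symm_apply] at h2

/-- Reflecting in the second zero reverses just one of the two edges at the first (here `n ≥ 3`
matters), although their product must be negative both before and after. -/
theorem not_adjacent_zeros {n : ℕ} (hn : 3 ≤ n) {i : Fin n} {x : Fin n → ℝ}
    (hx : x ∈ lyapDomain n) (hi : x i = 0) : x (finRotate n i) ≠ 0 := by
  intro hi'
  have h1 := eventually_edgeValue_opposite (by omega) hx hi
  obtain ⟨y, h2, h3⟩ := (h1.and ((tendsto_flipSign hi').eventually h1)).exists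
  have e1 : edgeValue (flipSign (finRotate n i) y) i = -edgeValue y i := by
    have := edgeValue_flipSign_pred (by omega : 2 ≤ n) (finRotate n i) y
    rwa [Equiv.symm_apply_apply] at this
  have e2 : edgeValue (flipSign (finRotate n i) y) ((finRotate n).symm i) =
      edgeValue y ((finRotate n).symm i) := by
    refine edgeValue_flipSign_of_ne ?_ ?_ y
    · intro h
      rw [Equiv.symm_apply_eq] at h
      exact finRotate_finRotate_ne_self hn i h.symm
    · rw [Equiv.symm_apply_apply]
      exact finRotate_symm_ne_self (by omega) i
  rw [e1, e2] at h3
  linarith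

/-- With `n` sign changes every edge is negative, whereas the two edges at a zero would have
opposite signs. -/
theorem ne_zero_of_lyapMin_eq {n : ℕ} (hn : 2 ≤ n) {x : Fin n → ℝ}
    (hx : x ∈ lyapDomain n) (h : lyapMin x = n) (i : Fin n) : x i ≠ 0 := by
  intro hi
  obtain ⟨y, h1, h2⟩ :=
    ((eventually_edgeValue_opposite hn hx hi).and (eventually_signChanges_eq hx)).exists
  rw [h, signChanges_eq_card] at h2
  have h3 : (Finset.univ.filter fun i => edgeValue y i < 0) = Finset.univ :=
    Finset.eq_univ_of_card _ (by simpa using h2)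
  have h4 : ∀ j, edgeValue y j < 0 := fun j => by
    have := Finset.mem_univ j
    rw [← h3] at this
    exact (Finset.mem_filter.1 this).2
  exact h1.not_gt (mul_pos_of_neg_of_neg (h4 _) (h4 _))

/-- Vectors whose zero coordinates all lie between coordinates of opposite (signed) signs. -/
def OppositeNeighbours {n : ℕ} (x : Fin n → ℝ) : Prop :=
  ∀ i, x i = 0 → edgeSign ((finRotate n).symm i) * x ((finRotate n).symm i) *
    (edgeSign i * x (finRotate n i)) < 0

/-- Under perturbation, the two edges at a zero contribute exactly one sign change together,
whichever sign the coordinate acquires. All other edges keep their sign. -/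
theorem OppositeNeighbours.mem_lyapDomain {n : ℕ} {x : Fin n → ℝ} (hx : OppositeNeighbours x) :
    x ∈ lyapDomain n := by
  have hnb : ∀ i, x (finRotate n i) = 0 → x i ≠ 0 := by
    intro i hi h
    have := hx _ hi
    rw [Equiv.symm_apply_apply, h] at this
    simp at this
  -- The contribution of an edge that starts at a zero of `x` is moved to the preceding edge. After
  -- this regrouping each summand is locally constant by itself.
  have formula : ∀ y : Fin n → ℝ, signChanges y =
      ∑ i, ((if x (finRotate n i) = 0 then if edgeValue y (finRotate n i) < 0 then 1 else 0 else 0)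
        + if x i = 0 then 0 else if edgeValue y i < 0 then 1 else 0) := by
    intro y
    rw [signChanges_eq_sum, Finset.sum_add_distrib, Equiv.sum_comp (finRotate n)
      (fun i => if x i = 0 then if edgeValue y i < 0 then 1 else 0 else 0),
      ← Finset.sum_add_distrib]
    refine Finset.sum_congr rfl fun i _ => ?_
    by_cases h : x i = 0 <;> simp [h]
  have key : ∀ᶠ y in 𝓝[nonvanishing n] x, ∀ i,
      ((if x (finRotate n i) = 0 then if edgeValue y (finRotate n i) < 0 then 1 else 0 else 0)
        + if x i = 0 then 0 else if edgeValue y i < 0 then 1 else 0) =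
      if x (finRotate n i) = 0 then 1 else if x i = 0 then 0 else
        if edgeValue x i < 0 then 1 else 0 := by
    refine eventually_all.2 fun i => ?_
    by_cases h1 : x (finRotate n i) = 0
    · have h2 := hx _ h1
      rw [Equiv.symm_apply_apply] at h2
      have hc : Continuous fun y : Fin n → ℝ => edgeSign i * y i *
          (edgeSign (finRotate n i) * y (finRotate n (finRotate n i))) := by fun_prop
      have h3 := (hc.continuousAt.eventually_lt_const h2).filter_mono
        (nhdsWithin_le_nhds (s := nonvanishing n))
      filter_upwards [h3, self_mem_nhdsWithin] with y hy hnv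
      have hm : edgeValue y i * edgeValue y (finRotate n i) < 0 := by
        have : edgeValue y i * edgeValue y (finRotate n i) =
            (y (finRotate n i) * y (finRotate n i)) * (edgeSign i * y i *
            (edgeSign (finRotate n i) * y (finRotate n (finRotate n i)))) := by
          unfold edgeValue
          ring
        rw [this]
        exact mul_neg_of_pos_of_neg (mul_self_pos.2 (hnv _)) hy
      simp only [h1, hnb i h1, if_true, if_false]
      rcases mul_neg_iff.1 hm with ⟨h4, h5⟩ | ⟨h4, h5⟩
      · simp [h4.le.not_gt, h5, -finRotate_apply]
      · simp [h5.le.not_gt, h4, -finRotate_apply]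
    · by_cases h2 : x i = 0
      · simp [h1, h2, -finRotate_apply]
      · simp only [h1, h2, if_false, zero_add]
        have h3 : edgeValue x i ≠ 0 := mul_ne_zero (mul_ne_zero (edgeSign_ne_zero i) h2) h1
        refine Eventually.filter_mono nhdsWithin_le_nhds ?_
        rcases lt_or_gt_of_ne h3 with h4 | h4
        · filter_upwards [(continuous_edgeValue i).continuousAt.eventually_lt_const h4] with y hy
          simp [hy, h4]
        · filter_upwards [(continuous_edgeValue i).continuousAt.eventually_const_lt h4] with y hy
          simp [hy.le.not_gt, h4.le.not_gt]
  refine mem_lyapDomain_of_eventually (c := ∑ i, if x (finRotate n i) = 0 then 1 else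
    if x i = 0 then 0 else if edgeValue x i < 0 then 1 else 0) ?_
  filter_upwards [key] with y hy
  rw [formula y]
  exact Finset.sum_congr rfl fun i _ => hy i

/-! ### Sublevel sets -/

/-- The closed cone of vectors with at most `c` sign changes. -/
def sublevel (n c : ℕ) : Set (Fin n → ℝ) :=
  closure {y | y ∈ nonvanishing n ∧ signChanges y ≤ c}

/-- The closure adds nothing beyond `N_m ≤ c` because `N_m` is lower semicontinuous, and nothing is
missing because the value `N_m x` is attained arbitrarily close to `x`. -/
theorem mem_sublevel_iff {n c : ℕ} {x : Fin n → ℝ} : x ∈ sublevel n c ↔ lyapMin x ≤ c := by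
  constructor
  · intro h
    have h1 : ∃ᶠ y in 𝓝 x, y ∈ nonvanishing n ∧ signChanges y ≤ c := mem_closure_iff_frequently.1 h
    obtain ⟨y, ⟨hy, hyc⟩, h2⟩ := (h1.and_eventually (eventually_lyapMin_le x)).exists
    rw [lyapMin_of_nonvanishing hy] at h2
    exact h2.trans hyc
  · intro h
    have h1 : ∃ᶠ y in 𝓝[nonvanishing n] x, signChanges y = lyapMin x := lyapMin_mem x
    refine mem_closure_iff_frequently.2 ?_
    have h2 := (h1.and_eventually self_mem_nhdsWithin).filter_mono nhdsWithin_le_nhds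
    exact h2.mono fun y hy => ⟨hy.2, hy.1.le.trans h⟩

/-- The value `v = 0` is reached as the limit of `ε * x i` for `ε → 0+`, along which no coordinate
changes sign. -/
theorem update_mem_sublevel {n : ℕ} (hn : 2 ≤ n) {c : ℕ} {i : Fin n} {x : Fin n → ℝ}
    (hx : x ∈ nonvanishing n) (hc : signChanges x ≤ c) {v : ℝ}
    (h : v * x i < 0 → edgeValue x i < 0 ∨ edgeValue x ((finRotate n).symm i) < 0) :
    Function.update x i v ∈ sublevel n c := by
  have hmem : ∀ w, w ≠ 0 → Function.update x i w ∈ nonvanishing n := by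
    intro w hw j
    rcases eq_or_ne j i with rfl | hj
    · simpa using hw
    · simpa [hj] using hx j
  by_cases hv : v = 0
  · have h1 : Tendsto (fun ε : ℝ => Function.update x i (ε * x i)) (𝓝[>] 0)
        (𝓝 (Function.update x i v)) := by
      have hcont : Continuous fun ε : ℝ => Function.update x i (ε * x i) :=
        continuous_const.update i (by fun_prop)
      have := hcont.tendsto 0
      simp only [zero_mul] at this
      rw [hv]
      exact this.mono_left nhdsWithin_le_nhds
    refine mem_closure_of_tendsto h1 ?_
    filter_upwards [self_mem_nhdsWithin] with ε hε
    have hε' : 0 < ε := hε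
    refine ⟨hmem _ (mul_ne_zero hε'.ne' (hx i)), (signChanges_update_le hn hx
      (mul_ne_zero hε'.ne' (hx i)) fun h2 => ?_).trans hc⟩
    have := mul_pos hε' (mul_self_pos.2 (hx i))
    linarith
  · exact subset_closure ⟨hmem v hv, (signChanges_update_le hn hx hv h).trans hc⟩

theorem mapsTo_sublevel {n c : ℕ} {f : (Fin n → ℝ) → Fin n → ℝ} (hf : Continuous f)
    (h : ∀ y ∈ nonvanishing n, signChanges y ≤ c → f y ∈ sublevel n c) :
    MapsTo f (sublevel n c) (sublevel n c) := by
  have : MapsTo f {y | y ∈ nonvanishing n ∧ signChanges y ≤ c} (sublevel n c) :=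
    fun y hy => h y hy.1 hy.2
  have h2 := this.closure hf
  rwa [sublevel, closure_closure] at h2

/-- The elementary matrices with nonnegative (signed) entries preserve the sublevel sets. -/
theorem update_add_mem_sublevel {n : ℕ} (hn : 2 ≤ n) {c : ℕ} {i j : Fin n} {w : ℝ}
    (h : (j = i ∧ 0 < 1 + w) ∨ (j = finRotate n i ∧ 0 ≤ edgeSign i * w) ∨
      (i = finRotate n j ∧ 0 ≤ edgeSign j * w)) {x : Fin n → ℝ} (hx : x ∈ sublevel n c) :
    Function.update x i (x i + w * x j) ∈ sublevel n c := by
  refine mapsTo_sublevel (f := fun x => Function.update x i (x i + w * x j))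
    (continuous_id.update i (by fun_prop)) (fun y hy hyc => ?_) hx
  -- If coordinate `i` changes sign, then `w * y i * y j < -(y i)²`. In the diagonal case this
  -- contradicts `0 < 1 + w`; otherwise, since `w` has the sign `δ`, the edge joining `i` and `j`
  -- must be a sign change.
  refine update_mem_sublevel hn hy hyc fun hneg => ?_
  have hsq := mul_self_pos.2 (hy i)
  rcases h with ⟨rfl, h⟩ | ⟨rfl, h⟩ | ⟨rfl, h⟩
  · have := mul_pos h hsq
    nlinarith
  · left
    have h1 : w * (y i * y (finRotate n i)) < 0 := by nlinarith
    unfold edgeValue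
    by_contra h2
    rw [not_lt] at h2
    have h3 := mul_nonneg h h2
    have : edgeSign i * w * (edgeSign i * y i * y (finRotate n i)) =
      (edgeSign i * edgeSign i) * (w * (y i * y (finRotate n i))) := by ring
    rw [this, edgeSign_mul_self] at h3
    linarith
  · right
    rw [Equiv.symm_apply_apply]
    have h1 : w * (y j * y (finRotate n j)) < 0 := by nlinarith
    unfold edgeValue
    by_contra h2
    rw [not_lt] at h2
    have h3 := mul_nonneg h h2
    have : edgeSign j * w * (edgeSign j * y j * y (finRotate n j)) =
      (edgeSign j * edgeSign j) * (w * (y j * y (finRotate n j))) := by ring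
    rw [this, edgeSign_mul_self] at h3
    linarith

/-! ### Linear differential equations -/

theorem isOpen_realIoo (α β : EReal) : IsOpen (realIoo α β) :=
  (isOpen_Ioo (a := α) (b := β)).preimage continuous_coe_real_ereal

theorem Icc_subset_realIoo {α β : EReal} {p q : ℝ} (hp : p ∈ realIoo α β) (hq : q ∈ realIoo α β) :
    Icc p q ⊆ realIoo α β := fun _ hτ =>
  ⟨hp.1.trans_le (EReal.coe_le_coe_iff.2 hτ.1), (EReal.coe_le_coe_iff.2 hτ.2).trans_lt hq.2⟩

theorem exists_mem_Ioo_Icc_subset_realIoo {α β : EReal} {s t : ℝ} (hs : s ∈ realIoo α β)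
    (ht : t ∈ realIoo α β) :
    ∃ p q, s ∈ Ioo p q ∧ t ∈ Ioo p q ∧ Icc p q ⊆ realIoo α β := by
  have key : ∀ r ∈ realIoo α β, ∃ p ∈ realIoo α β, ∃ q ∈ realIoo α β, r ∈ Ioo p q := by
    intro r hr
    obtain ⟨l, u, hlu, hsub⟩ := mem_nhds_iff_exists_Ioo_subset.1 ((isOpen_realIoo α β).mem_nhds hr)
    obtain ⟨p, hp⟩ := exists_between hlu.1
    obtain ⟨q, hq⟩ := exists_between hlu.2
    exact ⟨p, hsub ⟨hp.1, hp.2.trans hlu.2⟩, q, hsub ⟨hlu.1.trans hq.1, hq.2⟩, hp.2, hq.1⟩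
  have hmin : min s t ∈ realIoo α β := by
    rcases min_choice s t with h | h <;> rw [h] <;> assumption
  have hmax : max s t ∈ realIoo α β := by
    rcases max_choice s t with h | h <;> rw [h] <;> assumption
  obtain ⟨p, hp, _, _, hp'⟩ := key _ hmin
  obtain ⟨_, _, q, hq, hq'⟩ := key _ hmax
  have h1 := lt_min_iff.1 hp'.1
  have h2 := max_lt_iff.1 hq'.2
  exact ⟨p, q, ⟨h1.1, h2.1⟩, ⟨h1.2, h2.2⟩, Icc_subset_realIoo hp hq⟩

theorem exists_norm_mulVec_le {n : ℕ} {p q : ℝ} {A : ℝ → Matrix (Fin n) (Fin n) ℝ}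
    (hA : ContinuousOn A (Icc p q)) :
    ∃ M : NNReal, ∀ τ ∈ Icc p q, ∀ v, ‖(A τ).mulVec v‖ ≤ M * ‖v‖ := by
  have h1 : ∀ i j, ∃ C, ∀ τ ∈ Icc p q, ‖A τ i j‖ ≤ C := fun i j =>
    isCompact_Icc.exists_bound_of_continuousOn
      ((continuous_id.matrix_elem i j).comp_continuousOn hA)
  choose C hC using h1
  refine ⟨∑ i, ∑ j, (C i j).toNNReal, fun τ hτ v => ?_⟩
  refine (pi_norm_le_iff_of_nonneg (by positivity)).2 fun i => ?_
  have h2 : ‖(A τ).mulVec v i‖ ≤ ∑ j, ((C i j).toNNReal : ℝ) * ‖v‖ := by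
    rw [Matrix.mulVec_eq_sum, Finset.sum_apply]
    refine (norm_sum_le _ _).trans (Finset.sum_le_sum fun j _ => ?_)
    rw [Pi.smul_apply, MulOpposite.smul_eq_mul_unop, norm_mul]
    refine mul_le_mul ((hC i j τ hτ).trans (Real.le_coe_toNNReal _)) (norm_le_pi_norm v j)
      (norm_nonneg _) (NNReal.coe_nonneg _)
  refine h2.trans ?_
  rw [← Finset.sum_mul]
  push_cast
  refine mul_le_mul_of_nonneg_right ?_ (norm_nonneg v)
  exact Finset.single_le_sum (f := fun i => ∑ j, ((C i j).toNNReal : ℝ))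
    (fun i _ => Finset.sum_nonneg fun j _ => NNReal.coe_nonneg _) (Finset.mem_univ i)

theorem lipschitzWith_mulVec {n : ℕ} {B : Matrix (Fin n) (Fin n) ℝ} {M : NNReal}
    (h : ∀ v, ‖B.mulVec v‖ ≤ M * ‖v‖) : LipschitzWith M B.mulVec :=
  LipschitzWith.of_dist_le_mul fun v w => by
    rw [dist_eq_norm, dist_eq_norm, ← Matrix.mulVec_sub]
    exact h _

/-- The coordinatewise retraction onto a cube. -/
def clampCube {n : ℕ} (R : ℝ) (v : Fin n → ℝ) : Fin n → ℝ := fun i => max (-R) (min R (v i))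

theorem lipschitzWith_clampCube {n : ℕ} (R : ℝ) :
    LipschitzWith 1 (clampCube R : (Fin n → ℝ) → Fin n → ℝ) := by
  refine LipschitzWith.of_dist_le_mul fun v w => ?_
  rw [NNReal.coe_one, one_mul]
  refine (dist_pi_le_iff dist_nonneg).2 fun i => ?_
  have h : LipschitzWith 1 fun r : ℝ => max (-R) (min R r) :=
    (LipschitzWith.id.const_min R).const_max (-R)
  have := h.dist_le_mul (v i) (w i)
  rw [NNReal.coe_one, one_mul] at this
  exact this.trans (dist_le_pi_dist v w i)

theorem norm_clampCube_le {n : ℕ} {R : ℝ} (hR : 0 ≤ R) (v : Fin n → ℝ) : ‖clampCube R v‖ ≤ R :=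
  (pi_norm_le_iff_of_nonneg hR).2 fun i =>
    abs_le.2 ⟨le_max_left _ _, max_le (by linarith) (min_le_left _ _)⟩

theorem norm_clampCube_le_norm {n : ℕ} {R : ℝ} (hR : 0 ≤ R) (v : Fin n → ℝ) :
    ‖clampCube R v‖ ≤ ‖v‖ := by
  refine (pi_norm_le_iff_of_nonneg (norm_nonneg v)).2 fun i => ?_
  have h := abs_le.1 (norm_le_pi_norm v i)
  refine abs_le.2 ⟨?_, max_le (by linarith [norm_nonneg v]) ((min_le_right _ _).trans h.2)⟩
  exact le_max_of_le_right (le_min (by linarith [norm_nonneg v]) h.1)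

theorem clampCube_of_norm_le {n : ℕ} {R : ℝ} {v : Fin n → ℝ} (h : ‖v‖ ≤ R) :
    clampCube R v = v := by
  ext i
  have h := abs_le.1 ((norm_le_pi_norm v i).trans h)
  unfold clampCube
  rw [min_eq_right h.2, max_eq_right h.1]

/-- Grönwall's inequality in both time directions, the backward one by time reversal. It provides
the a priori bound behind global existence. -/
theorem norm_le_mul_exp_of_norm_deriv_le {E : Type*} [NormedAddCommGroup E] [NormedSpace ℝ E]
    {x x' : ℝ → E} {p q t₀ M : ℝ} (ht₀ : t₀ ∈ Icc p q) (hM : 0 ≤ M)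
    (hx : ∀ τ ∈ Icc p q, HasDerivWithinAt x (x' τ) (Icc p q) τ)
    (hb : ∀ τ ∈ Icc p q, ‖x' τ‖ ≤ M * ‖x τ‖) :
    ∀ τ ∈ Icc p q, ‖x τ‖ ≤ ‖x t₀‖ * Real.exp (M * (q - p)) := by
  have hcont : ContinuousOn x (Icc p q) := fun τ hτ => (hx τ hτ).continuousWithinAt
  intro τ hτ
  rcases le_total t₀ τ with h | h
  · have hsub : Icc t₀ q ⊆ Icc p q := Icc_subset_Icc_left ht₀.1
    have := norm_le_gronwallBound_of_norm_deriv_right_le (f := x) (f' := x') (δ := ‖x t₀‖)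
      (K := M) (ε := 0) (a := t₀) (b := q) (hcont.mono hsub)
      (fun u hu => ((hx u (hsub (Ico_subset_Icc_self hu))).mono
        (Icc_subset_Icc_left (ht₀.1.trans hu.1))).mono_of_mem_nhdsWithin
          (Icc_mem_nhdsGE hu.2)) le_rfl
      (fun u hu => by rw [add_zero]; exact hb u (hsub (Ico_subset_Icc_self hu))) τ ⟨h, hτ.2⟩
    rw [gronwallBound_ε0] at this
    refine this.trans (mul_le_mul_of_nonneg_left (Real.exp_le_exp.2
      (mul_le_mul_of_nonneg_left ?_ hM)) (norm_nonneg _))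
    linarith [ht₀.1, hτ.2]
  · have hmaps : ∀ u ∈ Icc (-t₀) (-p), -u ∈ Icc p q := fun u hu =>
      ⟨by linarith [hu.2], by linarith [hu.1, ht₀.2]⟩
    have := norm_le_gronwallBound_of_norm_deriv_right_le (f := fun u => x (-u))
      (f' := fun u => -x' (-u)) (δ := ‖x t₀‖)
      (K := M) (ε := 0) (a := -t₀) (b := -p)
      (hcont.comp continuousOn_neg hmaps)
      (fun u hu => by
        have h1 : HasDerivWithinAt x (x' (-u)) (Iic (-u)) (-u) :=
          ((hx (-u) (hmaps u (Ico_subset_Icc_self hu))).mono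
            (Icc_subset_Icc_right (by linarith [hu.1, ht₀.2]))).mono_of_mem_nhdsWithin
            (Icc_mem_nhdsLE (by linarith [hu.2]))
        have h2 := h1.scomp u (hasDerivAt_neg u).hasDerivWithinAt
          (fun v (hv : u ≤ v) => (neg_le_neg hv : -v ≤ -u))
        simpa using! h2) (by simp)
      (fun u hu => by
        rw [add_zero, norm_neg]
        exact hb _ (hmaps u (Ico_subset_Icc_self hu))) (-τ) ⟨by linarith, by linarith [hτ.1]⟩
    rw [gronwallBound_ε0, neg_neg] at this
    refine this.trans (mul_le_mul_of_nonneg_left (Real.exp_le_exp.2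
      (mul_le_mul_of_nonneg_left ?_ hM)) (norm_nonneg _))
    linarith [ht₀.2, hτ.1]

/-- The linear field is unbounded, so a Picard–Lindelöf theorem on balls does not reach all of `[p,
q]` at once. The field truncated outside a cube is bounded and does reach it; if the cube exceeds
the Grönwall bound, the truncation is never felt. -/
theorem exists_linear_solution_Icc {n : ℕ} {p q t₀ : ℝ} {A : ℝ → Matrix (Fin n) (Fin n) ℝ}
    (hA : ContinuousOn A (Icc p q)) (ht₀ : t₀ ∈ Icc p q) (x₀ : Fin n → ℝ) :
    ∃ x : ℝ → Fin n → ℝ, x t₀ = x₀ ∧ ∀ τ ∈ Ioo p q, HasDerivAt x ((A τ).mulVec (x τ)) τ := by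
  obtain ⟨M, hM⟩ := exists_norm_mulVec_le hA
  -- The Grönwall bound itself. It holds for the truncated field too, because truncation does not
  -- increase the norm.
  set R : NNReal := ⟨‖x₀‖ * Real.exp (M * (q - p)), by positivity⟩ with hR
  have hpq : 0 ≤ q - p := sub_nonneg.2 (ht₀.1.trans ht₀.2)
  have pl : IsPicardLindelof (fun τ v => (A τ).mulVec (clampCube R v)) (tmin := p) (tmax := q)
      ⟨t₀, ht₀⟩ x₀ (M * R * ⟨q - p, hpq⟩) 0 (M * R) (M * 1) := by
    refine ⟨fun τ hτ => ?_, fun v _ => ?_, fun τ hτ v _ => ?_, ?_⟩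
    · exact ((lipschitzWith_mulVec (hM τ hτ)).comp (lipschitzWith_clampCube R)).lipschitzOnWith
    · have hc : Continuous fun B : Matrix (Fin n) (Fin n) ℝ => B.mulVec (clampCube R v) :=
        continuous_id.matrix_mulVec continuous_const
      exact hc.comp_continuousOn hA
    · refine (hM τ hτ _).trans ?_
      push_cast
      exact mul_le_mul_of_nonneg_left (norm_clampCube_le R.2 v) M.2
    · push_cast
      rw [sub_zero]
      refine mul_le_mul_of_nonneg_left ?_ (mul_nonneg M.2 R.2)
      exact max_le (sub_le_sub_left ht₀.1 q) (sub_le_sub_right ht₀.2 p)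
  obtain ⟨x, hx0, hx⟩ := pl.exists_eq_forall_mem_Icc_hasDerivWithinAt₀
  have hbound := norm_le_mul_exp_of_norm_deriv_le ht₀ M.2 hx fun τ hτ =>
    (hM τ hτ _).trans (mul_le_mul_of_nonneg_left (norm_clampCube_le_norm R.2 _) M.2)
  refine ⟨x, hx0, fun τ hτ => ?_⟩
  have h1 := (hx τ (Ioo_subset_Icc_self hτ)).hasDerivAt (Icc_mem_nhds hτ.1 hτ.2)
  have h2 := hbound τ (Ioo_subset_Icc_self hτ)
  rw [show x t₀ = x₀ from hx0] at h2
  have h3 : clampCube R (x τ) = x τ := clampCube_of_norm_le h2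
  simpa only [h3] using h1

theorem linear_solution_unique_Ioo {n : ℕ} {p q t₀ : ℝ} {A : ℝ → Matrix (Fin n) (Fin n) ℝ}
    (hA : ContinuousOn A (Icc p q)) (ht₀ : t₀ ∈ Ioo p q) {x y : ℝ → Fin n → ℝ}
    (hx : ∀ τ ∈ Ioo p q, HasDerivAt x ((A τ).mulVec (x τ)) τ)
    (hy : ∀ τ ∈ Ioo p q, HasDerivAt y ((A τ).mulVec (y τ)) τ) (h : x t₀ = y t₀) :
    EqOn x y (Ioo p q) := by
  obtain ⟨M, hM⟩ := exists_norm_mulVec_le hA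
  exact ODE_solution_unique_of_mem_Ioo (v := fun τ v => (A τ).mulVec v) (s := fun _ => univ)
    (K := M) (fun τ hτ => (lipschitzWith_mulVec (hM τ (Ioo_subset_Icc_self hτ))).lipschitzOnWith)
    ht₀ (fun τ hτ => ⟨hx τ hτ, trivial⟩) (fun τ hτ => ⟨hy τ hτ, trivial⟩) h

section LinearSolution

variable {n : ℕ} {α β : EReal} {A : ℝ → Matrix (Fin n) (Fin n) ℝ}

theorem IsLinearSolution.eqOn (hA : ContinuousOn A (realIoo α β)) {x y : ℝ → Fin n → ℝ}
    (hx : IsLinearSolution α β A x) (hy : IsLinearSolution α β A y) {s : ℝ}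
    (hs : s ∈ realIoo α β) (h : x s = y s) : EqOn x y (realIoo α β) := by
  intro t ht
  obtain ⟨p, q, hsp, htp, hsub⟩ := exists_mem_Ioo_Icc_subset_realIoo hs ht
  have hsub' := Ioo_subset_Icc_self.trans hsub
  exact linear_solution_unique_Ioo (hA.mono hsub) hsp (fun τ hτ => hx τ (hsub' hτ))
    (fun τ hτ => hy τ (hsub' hτ)) h htp

/-- Solutions on compact intervals containing `s` agree on overlaps, so the diagonal choice `X τ τ`
is locally one of them. -/
theorem exists_isLinearSolution (hA : ContinuousOn A (realIoo α β)) {s : ℝ}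
    (hs : s ∈ realIoo α β) (x₀ : Fin n → ℝ) : ∃ x, IsLinearSolution α β A x ∧ x s = x₀ := by
  have h1 : ∀ t ∈ realIoo α β, ∃ p q, ∃ x : ℝ → Fin n → ℝ, s ∈ Ioo p q ∧ t ∈ Ioo p q ∧
      Icc p q ⊆ realIoo α β ∧ x s = x₀ ∧
      ∀ τ ∈ Ioo p q, HasDerivAt x ((A τ).mulVec (x τ)) τ := by
    intro t ht
    obtain ⟨p, q, hsp, htp, hsub⟩ := exists_mem_Ioo_Icc_subset_realIoo hs ht
    obtain ⟨x, hx0, hx⟩ := exists_linear_solution_Icc (hA.mono hsub) (Ioo_subset_Icc_self hsp) x₀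
    exact ⟨p, q, x, hsp, htp, hsub, hx0, hx⟩
  choose! p q X hsp htp hsub hX0 hX using h1
  have hglue : ∀ t ∈ realIoo α β, ∀ τ ∈ Ioo (p t) (q t), X τ τ = X t τ := by
    intro t ht τ hτ
    have hτ' := hsub t ht (Ioo_subset_Icc_self hτ)
    have hsub1 : Ioo (max (p t) (p τ)) (min (q t) (q τ)) ⊆ Ioo (p t) (q t) :=
      Ioo_subset_Ioo (le_max_left _ _) (min_le_left _ _)
    have hsub2 : Ioo (max (p t) (p τ)) (min (q t) (q τ)) ⊆ Ioo (p τ) (q τ) :=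
      Ioo_subset_Ioo (le_max_right _ _) (min_le_right _ _)
    have hmem : ∀ r, r ∈ Ioo (p t) (q t) → r ∈ Ioo (p τ) (q τ) →
        r ∈ Ioo (max (p t) (p τ)) (min (q t) (q τ)) := fun r h h' =>
      ⟨max_lt h.1 h'.1, lt_min h.2 h'.2⟩
    exact linear_solution_unique_Ioo
      (hA.mono ((Icc_subset_Icc (le_max_left _ _) (min_le_left _ _)).trans (hsub t ht)))
      (hmem s (hsp t ht) (hsp τ hτ')) (fun r hr => hX τ hτ' r (hsub2 hr))
      (fun r hr => hX t ht r (hsub1 hr)) ((hX0 τ hτ').trans (hX0 t ht).symm)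
      (hmem τ hτ (htp τ hτ'))
  refine ⟨fun τ => X τ τ, fun t ht => ?_, hX0 s hs⟩
  have h2 : (fun τ => X τ τ) =ᶠ[𝓝 t] X t := by
    filter_upwards [Ioo_mem_nhds (htp t ht).1 (htp t ht).2] with τ hτ using hglue t ht τ hτ
  exact (hX t ht t (htp t ht)).congr_of_eventuallyEq h2

theorem IsLinearSolution.add {x y : ℝ → Fin n → ℝ}
    (hx : IsLinearSolution α β A x) (hy : IsLinearSolution α β A y) :
    IsLinearSolution α β A (x + y) := fun τ hτ => by
  rw [Pi.add_apply, Matrix.mulVec_add]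
  exact (hx τ hτ).add (hy τ hτ)

theorem IsLinearSolution.smul {x : ℝ → Fin n → ℝ} (c : ℝ)
    (hx : IsLinearSolution α β A x) : IsLinearSolution α β A (c • x) := fun τ hτ => by
  rw [Pi.smul_apply, Matrix.mulVec_smul]
  exact (hx τ hτ).const_smul c

theorem exists_isSolutionOperator (hA : ContinuousOn A (realIoo α β)) {s t : ℝ}
    (hs : s ∈ realIoo α β) (ht : t ∈ realIoo α β) :
    ∃ S : (Fin n → ℝ) →ₗ[ℝ] (Fin n → ℝ), IsSolutionOperator α β A s t S := by
  choose X hX hX0 using fun x₀ : Fin n → ℝ => exists_isLinearSolution hA hs x₀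
  refine ⟨{ toFun := fun x₀ => X x₀ t, map_add' := fun x y => ?_, map_smul' := fun c x => ?_ },
    fun x₀ => ⟨X x₀, hX x₀, hX0 x₀⟩, fun x hx => ?_⟩
  · exact (hX _).eqOn hA ((hX x).add (hX y)) hs (by simp [hX0]) ht
  · exact (hX _).eqOn hA ((hX x).smul c) hs (by simp [hX0]) ht
  · exact (hX _).eqOn hA hx hs (hX0 _) ht

theorem IsSolutionOperator.symm_apply {s t : ℝ} {S T : (Fin n → ℝ) →ₗ[ℝ] (Fin n → ℝ)}
    (hS : IsSolutionOperator α β A s t S) (hT : IsSolutionOperator α β A t s T)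
    (v : Fin n → ℝ) : T (S v) = v := by
  obtain ⟨x, hx, rfl⟩ := hS.exists_solution v
  rw [hS.map_solution x hx, hT.map_solution x hx]

end LinearSolution

/-! ### Matrices of negative feedback systems -/

theorem negativeFeedbackSigns_iff {n : ℕ} {b : Fin n → ℝ} :
    NegativeFeedbackSigns b ↔ ∀ i, 0 < edgeSign i * b i := by
  refine forall_congr' fun i => ?_
  unfold edgeSign
  split_ifs <;> simp

theorem cyclicTridiagonal_succ {n : ℕ} (hn : 3 ≤ n) (a b c : Fin n → ℝ) (i : Fin n) :
    cyclicTridiagonal a b c i (finRotate n i) = b i := by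
  rw [cyclicTridiagonal, Matrix.of_apply, if_neg (finRotate_ne_self (by omega) i), if_pos rfl]

theorem cyclicTridiagonal_pred {n : ℕ} (hn : 3 ≤ n) (a b c : Fin n → ℝ) (i : Fin n) :
    cyclicTridiagonal a b c (finRotate n i) i = c i := by
  rw [cyclicTridiagonal, Matrix.of_apply, if_neg (finRotate_ne_self (by omega) i).symm,
    if_neg (finRotate_finRotate_ne_self hn i).symm, if_pos rfl]

/-- Evaluated at a successor, so that both neighbours are expressed without the inverse rotation. -/
theorem cyclicTridiagonal_mulVec {n : ℕ} (hn : 3 ≤ n) (a b c x : Fin n → ℝ) (i : Fin n) :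
    (cyclicTridiagonal a b c).mulVec x (finRotate n i) = a (finRotate n i) * x (finRotate n i) +
      (b (finRotate n i) * x (finRotate n (finRotate n i)) + c i * x i) := by
  have h1 := finRotate_ne_self (by omega : 2 ≤ n) (finRotate n i)
  have h2 := finRotate_ne_self (by omega : 2 ≤ n) i
  have h3 := finRotate_finRotate_ne_self hn i
  rw [Matrix.mulVec, dotProduct, ← Finset.add_sum_erase _ _ (Finset.mem_univ (finRotate n i)),
    ← Finset.add_sum_erase _ _ (Finset.mem_erase.2 ⟨h1, Finset.mem_univ _⟩),
    ← Finset.add_sum_erase _ _ (Finset.mem_erase.2 ⟨h3.symm,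
      Finset.mem_erase.2 ⟨h2.symm, Finset.mem_univ _⟩⟩), Finset.sum_eq_zero, add_zero,
    cyclicTridiagonal_succ hn, cyclicTridiagonal_pred hn]
  · rw [cyclicTridiagonal, Matrix.of_apply, if_pos rfl]
  · intro j hj
    simp only [Finset.mem_erase, Finset.mem_univ, and_true] at hj
    rw [cyclicTridiagonal, Matrix.of_apply, if_neg hj.2.2, if_neg hj.2.1,
      if_neg fun h => hj.1 ((finRotate n).injective h).symm, zero_mul]

/-- The signed off-diagonal entries of a matrix in `MMinus` are nonnegative, and those on one side
of the diagonal are positive. -/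
theorem exists_eq_cyclicTridiagonal_of_mem_MMinus {n : ℕ} {B : Matrix (Fin n) (Fin n) ℝ}
    (hB : B ∈ MMinus n) : ∃ a b c : Fin n → ℝ, B = cyclicTridiagonal a b c ∧
      (∀ i, 0 ≤ edgeSign i * b i) ∧ (∀ i, 0 ≤ edgeSign i * c i) ∧
      ((∀ i, 0 < edgeSign i * b i) ∨ ∀ i, 0 < edgeSign i * c i) := by
  obtain ⟨a, b, c, rfl, hbc, -, h⟩ := hB
  rw [negativeFeedbackSigns_iff, negativeFeedbackSigns_iff] at h
  have key : ∀ i, 0 ≤ (edgeSign i * b i) * (edgeSign i * c i) := by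
    intro i
    have : (edgeSign i * b i) * (edgeSign i * c i) = (edgeSign i * edgeSign i) * (b i * c i) := by
      ring
    rw [this, edgeSign_mul_self, one_mul]
    exact hbc i
  refine ⟨a, b, c, rfl, fun i => ?_, fun i => ?_, h⟩
  · rcases h with h | h
    · exact (h i).le
    · exact nonneg_of_mul_nonneg_left (key i) (h i)
  · rcases h with h | h
    · exact nonneg_of_mul_nonneg_right (key i) (h i)
    · exact (h i).le

/-! ### Invariance of the sublevel sets -/

/-- The sublevel sets are subtangential to the vector fields of negative feedback systems. -/
theorem exists_curve_in_sublevel {n c : ℕ} (hn : 3 ≤ n) {B : Matrix (Fin n) (Fin n) ℝ}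
    (hB : B ∈ MMinus n) {z : Fin n → ℝ} (hz : z ∈ sublevel n c) :
    ∃ Φ : ℝ → Fin n → ℝ, Φ 0 = z ∧ HasDerivAt Φ (B.mulVec z) 0 ∧
      ∀ᶠ h in 𝓝[>] 0, Φ h ∈ sublevel n c := by
  obtain ⟨a, b, c', hBeq, hb, hc, -⟩ := exists_eq_cyclicTridiagonal_of_mem_MMinus hB
  -- One elementary update with weight `h * B i j` is composed for each matrix entry. At `h = 0` the
  -- derivative of the composition is the sum of the derivatives of the updates, so over all entries
  -- it is `B.mulVec z`, while each update keeps the curve in the cone for small `h > 0`.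
  have key : ∀ s : Finset (Fin n × Fin n), ∃ Φ : ℝ → Fin n → ℝ, Φ 0 = z ∧
      HasDerivAt Φ (∑ p ∈ s, (B p.1 p.2 * z p.2) • (Pi.single p.1 1 : Fin n → ℝ)) 0 ∧
      ∀ᶠ h in 𝓝[>] 0, Φ h ∈ sublevel n c := by
    intro s
    induction s using Finset.induction_on with
    | empty => exact ⟨fun _ => z, rfl, by simpa using hasDerivAt_const (0 : ℝ) z,
        Eventually.of_forall fun _ => hz⟩
    | insert p s hp ih =>
      obtain ⟨Φ, h0, hd, hmem⟩ := ih
      obtain ⟨i, j⟩ := p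
      refine ⟨fun h => Φ h + (h * B i j * Φ h j) • (Pi.single i 1 : Fin n → ℝ), by simp [h0], ?_, ?_⟩
      · rw [Finset.sum_insert hp, add_comm]
        refine hd.add (HasDerivAt.smul_const ?_ _)
        have h1 : HasDerivAt (fun h : ℝ => h * B i j) (B i j) 0 := by
          simpa using (hasDerivAt_id (0 : ℝ)).mul_const (B i j)
        have h2 := h1.mul (hasDerivAt_pi.1 hd j)
        simpa [h0] using! h2
      · have hupd : ∀ h, Φ h + (h * B i j * Φ h j) • (Pi.single i 1 : Fin n → ℝ) =
            Function.update (Φ h) i (Φ h i + h * B i j * Φ h j) := by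
          intro h
          ext k
          rcases eq_or_ne k i with rfl | hk <;> simp [*]
        have hdiag : ∀ᶠ h : ℝ in 𝓝[>] 0, 0 < 1 + h * B i j := by
          have hcont : Continuous fun h : ℝ => 1 + h * B i j := by fun_prop
          exact (hcont.continuousAt.eventually_const_lt (by simp)).filter_mono nhdsWithin_le_nhds
        filter_upwards [hmem, hdiag, self_mem_nhdsWithin] with h h1 h2 h3
        have h3 : 0 < h := h3
        rw [hupd]
        by_cases e1 : j = i
        · exact update_add_mem_sublevel (by omega) (Or.inl ⟨e1, h2⟩) h1
        by_cases e2 : j = finRotate n i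
        · refine update_add_mem_sublevel (by omega) (Or.inr (Or.inl ⟨e2, ?_⟩)) h1
          rw [e2, hBeq, cyclicTridiagonal_succ hn, mul_left_comm]
          exact mul_nonneg h3.le (hb i)
        by_cases e3 : i = finRotate n j
        · refine update_add_mem_sublevel (by omega) (Or.inr (Or.inr ⟨e3, ?_⟩)) h1
          rw [e3, hBeq, cyclicTridiagonal_pred hn, mul_left_comm]
          exact mul_nonneg h3.le (hc j)
        have hzero : B i j = 0 := by
          simp only [hBeq, cyclicTridiagonal, Matrix.of_apply, if_neg e1, if_neg e2, if_neg e3]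
        rw [hzero, mul_zero, zero_mul, add_zero, Function.update_eq_self]
        exact h1
  obtain ⟨Φ, h0, hd, hmem⟩ := key Finset.univ
  refine ⟨Φ, h0, ?_, hmem⟩
  convert hd using 1
  ext i
  rw [Fintype.sum_prod_type, Matrix.mulVec, dotProduct]
  symm
  rw [Finset.sum_apply, Finset.sum_eq_single i (fun k _ hk => ?_) fun h => absurd (Finset.mem_univ i) h]
  · simp
  · rw [Finset.sum_apply]
    exact Finset.sum_eq_zero fun j _ => by simp [hk.symm]

section Flow

variable {n : ℕ} {α β : EReal} {A : ℝ → Matrix (Fin n) (Fin n) ℝ}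

/-- Let `z` be a point of the cone nearest to `x τ` and `Φ` a curve in the cone leaving `z` with
velocity `A z`. The distance to the cone is at most the distance to `Φ`, whose growth rate is at
most `‖A (x τ - z)‖ ≤ M * dist`. Grönwall's inequality keeps it at zero. -/
theorem mem_sublevel_of_isLinearSolution (hn : 3 ≤ n) (hcont : ContinuousOn A (realIoo α β))
    (hA : ∀ τ ∈ realIoo α β, A τ ∈ MMinus n) {x : ℝ → Fin n → ℝ} (hx : IsLinearSolution α β A x)
    {s t : ℝ} (hs : s ∈ realIoo α β) (ht : t ∈ realIoo α β) (hst : s ≤ t) {c : ℕ}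
    (hc : x s ∈ sublevel n c) : x t ∈ sublevel n c := by
  have hsub := Icc_subset_realIoo hs ht
  obtain ⟨M, hM⟩ := exists_norm_mulVec_le (hcont.mono hsub)
  have hclosed : IsClosed (sublevel n c) := isClosed_closure
  have hne : (sublevel n c).Nonempty := ⟨_, hc⟩
  have hxc : ContinuousOn x (Icc s t) := fun τ hτ =>
    (hx τ (hsub hτ)).continuousAt.continuousWithinAt
  have h := le_gronwallBound_of_liminf_deriv_right_le
    (f := fun τ => Metric.infDist (x τ) (sublevel n c))
    (f' := fun τ => M * Metric.infDist (x τ) (sublevel n c)) (δ := 0) (K := M) (ε := 0)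
    ((Metric.continuous_infDist_pt _).comp_continuousOn hxc) ?_
    (Metric.infDist_zero_of_mem hc).le (fun τ _ => by rw [add_zero]) t ⟨hst, le_rfl⟩
  · rw [gronwallBound_ε0_δ0] at h
    exact (hclosed.mem_iff_infDist_zero hne).2 (le_antisymm h Metric.infDist_nonneg)
  · intro τ hτ r hr
    have hτ' := hsub (Ico_subset_Icc_self hτ)
    obtain ⟨z, hz, hdist⟩ := hclosed.exists_infDist_eq_dist hne (x τ)
    obtain ⟨Φ, h0, hd, hmem⟩ := exists_curve_in_sublevel hn (hA τ hτ') hz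
    have hd' : HasDerivAt (fun σ => Φ (σ - τ)) ((A τ).mulVec z) τ := by
      have h1 : HasDerivAt Φ ((A τ).mulVec z) (τ - τ) := by rwa [sub_self]
      simpa using! HasDerivAt.scomp (h := fun σ => σ - τ) τ h1 ((hasDerivAt_id τ).sub_const τ)
    have hg : HasDerivAt (fun σ => x σ - Φ (σ - τ)) ((A τ).mulVec (x τ - z)) τ := by
      rw [Matrix.mulVec_sub]
      exact (hx τ hτ').sub hd'
    have hnorm : ‖(A τ).mulVec (x τ - z)‖ < r := by
      refine lt_of_le_of_lt (hM τ (Ico_subset_Icc_self hτ) _) ?_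
      rwa [← dist_eq_norm, ← hdist]
    have hfreq := (hg.hasDerivWithinAt (s := Ici τ)).liminf_right_slope_norm_le hnorm
    have hmem' : ∀ᶠ σ in 𝓝[>] τ, Φ (σ - τ) ∈ sublevel n c := by
      have htend : Tendsto (fun σ => σ - τ) (𝓝[>] τ) (𝓝[>] 0) := by
        refine tendsto_nhdsWithin_of_tendsto_nhds_of_eventually_within _ ?_ ?_
        · have : Continuous fun σ : ℝ => σ - τ := by fun_prop
          simpa using (this.tendsto τ).mono_left (nhdsWithin_le_nhds (s := Ioi τ))
        · filter_upwards [self_mem_nhdsWithin] with σ hσ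
          exact mem_Ioi.2 (sub_pos.2 (mem_Ioi.1 hσ))
      exact htend.eventually hmem
    refine ((hfreq.and_eventually hmem').and_eventually self_mem_nhdsWithin).mono ?_
    rintro σ ⟨⟨h1, h2⟩, h3⟩
    refine lt_of_le_of_lt (mul_le_mul_of_nonneg_left ?_ (inv_nonneg.2 (sub_nonneg.2 (le_of_lt h3))))
      h1
    rw [sub_self, h0, ← dist_eq_norm (x τ), ← hdist, ← dist_eq_norm]
    exact sub_le_sub_right (Metric.infDist_le_dist_of_mem h2) _

theorem lyapMin_antitone_of_isSolutionOperator (hn : 3 ≤ n) (hcont : ContinuousOn A (realIoo α β))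
    (hA : ∀ τ ∈ realIoo α β, A τ ∈ MMinus n) {s t : ℝ} (hs : s ∈ realIoo α β)
    (ht : t ∈ realIoo α β) (hst : s ≤ t) {S : (Fin n → ℝ) →ₗ[ℝ] (Fin n → ℝ)}
    (hS : IsSolutionOperator α β A s t S) (v : Fin n → ℝ) : lyapMin (S v) ≤ lyapMin v := by
  obtain ⟨x, hx, rfl⟩ := hS.exists_solution v
  rw [hS.map_solution x hx, ← mem_sublevel_iff]
  exact mem_sublevel_of_isLinearSolution hn hcont hA hx hs ht hst (mem_sublevel_iff.2 le_rfl)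

/-! ### Times at which the Lyapunov function is defined -/

theorem forall_of_finRotate {n : ℕ} (hn : 2 ≤ n) {P : Fin n → Prop} {i : Fin n} (hi : P i)
    (h : ∀ j, P j → P (finRotate n j)) (j : Fin n) : P j := by
  have hcyc : (finRotate n).IsCycle := by
    obtain ⟨m, rfl⟩ : ∃ m, n = m + 2 := ⟨n - 2, by omega⟩
    exact isCycle_finRotate
  obtain ⟨k, rfl⟩ := hcyc.exists_pow_eq (finRotate_ne_self hn i) (finRotate_ne_self hn j)
  induction k with
  | zero => exact hi
  | succ k ih =>
    rw [pow_succ', Equiv.Perm.mul_apply]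
    exact h _ ih

theorem forall_of_finRotate_symm {n : ℕ} (hn : 2 ≤ n) {P : Fin n → Prop} {i : Fin n} (hi : P i)
    (h : ∀ j, P (finRotate n j) → P j) (j : Fin n) : P j := by
  by_contra hj
  exact forall_of_finRotate hn (P := fun k => ¬P k) hj (fun k hk hk' => hk (h k hk')) i hi

/-- If the nonzero vector `x` vanishes only at equilibria of the corresponding components of the
vector field, then its zeros lie between coordinates of opposite signs. -/
theorem oppositeNeighbours_of_mulVec {n : ℕ} (hn : 3 ≤ n) {B : Matrix (Fin n) (Fin n) ℝ}
    (hB : B ∈ MMinus n) {x : Fin n → ℝ} (hx : x ≠ 0)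
    (h : ∀ i, x i = 0 → B.mulVec x i = 0) : OppositeNeighbours x := by
  obtain ⟨a, b, c, rfl, hb, hc, hbc⟩ := exists_eq_cyclicTridiagonal_of_mem_MMinus hB
  have heq : ∀ i, x (finRotate n i) = 0 →
      b (finRotate n i) * x (finRotate n (finRotate n i)) + c i * x i = 0 := by
    intro i hi
    have := h _ hi
    rwa [cyclicTridiagonal_mulVec hn, hi, mul_zero, zero_add] at this
  -- Two adjacent zeros spread around the whole cycle through the equation: forwards if the `b i` do
  -- not vanish, backwards if the `c i` do not.
  have hzero : ∀ i, x i = 0 → x (finRotate n i) ≠ 0 := by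
    intro i hi hi'
    refine hx (funext fun j => ?_)
    rcases hbc with hb | hc
    · refine (forall_of_finRotate (by omega) (P := fun j => x j = 0 ∧ x (finRotate n j) = 0)
        ⟨hi, hi'⟩ (fun k hk => ⟨hk.2, ?_⟩) j).1
      have := heq k hk.2
      rw [hk.1, mul_zero, add_zero] at this
      exact (mul_eq_zero.1 this).resolve_left fun h0 => (hb (finRotate n k)).ne' (by rw [h0, mul_zero])
    · refine (forall_of_finRotate_symm (by omega) (P := fun j => x j = 0 ∧ x (finRotate n j) = 0)
        ⟨hi, hi'⟩ (fun k hk => ⟨?_, hk.1⟩) j).1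
      have := heq k hk.1
      rw [hk.2, mul_zero, zero_add] at this
      exact (mul_eq_zero.1 this).resolve_left fun h0 => (hc k).ne' (by rw [h0, mul_zero])
  intro i' hi
  obtain ⟨i, rfl⟩ := (finRotate n).surjective i'
  rw [Equiv.symm_apply_apply]
  have h1 : x i ≠ 0 := fun h0 => hzero i h0 hi
  have h2 : x (finRotate n (finRotate n i)) ≠ 0 := hzero _ hi
  have h3 := heq i hi
  have d1 := edgeSign_mul_self i
  have d2 := edgeSign_mul_self (finRotate n i)
  by_contra hcon
  have hpos : 0 < edgeSign i * x i *
      (edgeSign (finRotate n i) * x (finRotate n (finRotate n i))) :=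
    lt_of_le_of_ne (not_lt.1 hcon) (mul_ne_zero (mul_ne_zero (edgeSign_ne_zero _) h1)
      (mul_ne_zero (edgeSign_ne_zero _) h2)).symm
  set X := edgeSign i * x i
  set Y := edgeSign (finRotate n i) * x (finRotate n (finRotate n i))
  set u := edgeSign (finRotate n i) * b (finRotate n i) with hu
  set w := edgeSign i * c i with hw
  -- In signed quantities the equation at a zero is `u * Y + w * X = 0` with `u, w ≥ 0`, one of them
  -- positive. Multiplying by `X` or by `Y` rules out `X * Y > 0`.
  have h4 : u * Y + w * X = 0 := by
    have : u * Y + w * X = (edgeSign (finRotate n i) * edgeSign (finRotate n i)) *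
        (b (finRotate n i) * x (finRotate n (finRotate n i))) +
        (edgeSign i * edgeSign i) * (c i * x i) := by
      simp only [u, w, X, Y]
      ring
    rw [this, d1, d2, one_mul, one_mul, h3]
  have h5 : u * (X * Y) + w * (X * X) = 0 := by linear_combination X * h4
  have h6 : u * (Y * Y) + w * (X * Y) = 0 := by linear_combination Y * h4
  have hX : 0 ≤ X * X := mul_self_nonneg X
  have hY : 0 ≤ Y * Y := mul_self_nonneg Y
  rcases hbc with hb' | hc'
  · have := mul_pos (hb' (finRotate n i)) hpos
    have := mul_nonneg (hc i) hX
    linarith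
  · have := mul_pos (hc' i) hpos
    have := mul_nonneg (hb (finRotate n i)) hY
    linarith

/-- The interval is shrunk for one coordinate at a time: if the coordinate is nonzero somewhere, it
is nonzero nearby, and earlier alternatives pass to subintervals. No analyticity is needed. -/
theorem exists_Ioo_forall_zero_or_forall_ne {n : ℕ} {s t : ℝ} (hst : s < t)
    {x : ℝ → Fin n → ℝ} (hx : ContinuousOn x (Ioo s t)) :
    ∃ p q, p < q ∧ Ioo p q ⊆ Ioo s t ∧
      ∀ i, (∀ τ ∈ Ioo p q, x τ i = 0) ∨ ∀ τ ∈ Ioo p q, x τ i ≠ 0 := by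
  have key : ∀ F : Finset (Fin n), ∃ p q, p < q ∧ Ioo p q ⊆ Ioo s t ∧
      ∀ i ∈ F, (∀ τ ∈ Ioo p q, x τ i = 0) ∨ ∀ τ ∈ Ioo p q, x τ i ≠ 0 := by
    intro F
    induction F using Finset.induction_on with
    | empty => exact ⟨s, t, hst, Subset.rfl, by simp⟩
    | insert i F hi ih =>
      obtain ⟨p, q, hpq, hsub, h⟩ := ih
      by_cases h0 : ∀ τ ∈ Ioo p q, x τ i = 0
      · refine ⟨p, q, hpq, hsub, fun j hj => ?_⟩
        rcases Finset.mem_insert.1 hj with rfl | hj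
        · exact Or.inl h0
        · exact h j hj
      · push Not at h0
        obtain ⟨τ, hτ, hne⟩ := h0
        have hcont : ContinuousAt (fun τ => x τ i) τ :=
          (continuous_apply i).continuousAt.comp (hx.continuousAt (Ioo_mem_nhds (hsub hτ).1 (hsub hτ).2))
        obtain ⟨p', q', hpq', hsub'⟩ := mem_nhds_iff_exists_Ioo_subset.1
          (inter_mem (Ioo_mem_nhds hτ.1 hτ.2) (hcont.eventually_ne hne))
        refine ⟨p', q', hpq'.1.trans hpq'.2, fun σ hσ => hsub (hsub' hσ).1, fun j hj => ?_⟩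
        rcases Finset.mem_insert.1 hj with rfl | hj
        · exact Or.inr fun σ hσ => (hsub' hσ).2
        · exact (h j hj).imp (fun h σ hσ => h σ (hsub' hσ).1) (fun h σ hσ => h σ (hsub' hσ).1)
  obtain ⟨p, q, hpq, hsub, h⟩ := key Finset.univ
  exact ⟨p, q, hpq, hsub, fun i => h i (Finset.mem_univ i)⟩

/-- On the interval just found, a coordinate that vanishes does so identically, so its derivative
vanishes as well, as `oppositeNeighbours_of_mulVec` requires. -/
theorem exists_mem_lyapDomain_of_isLinearSolution (hn : 3 ≤ n)
    (hA : ∀ τ ∈ realIoo α β, A τ ∈ MMinus n) {x : ℝ → Fin n → ℝ} (hx : IsLinearSolution α β A x)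
    (hne : ∀ τ ∈ realIoo α β, x τ ≠ 0) {s t : ℝ} (hs : s ∈ realIoo α β) (ht : t ∈ realIoo α β)
    (hst : s < t) : ∃ τ ∈ Ioo s t, x τ ∈ lyapDomain n := by
  have hsub : Ioo s t ⊆ realIoo α β := Ioo_subset_Icc_self.trans (Icc_subset_realIoo hs ht)
  obtain ⟨p, q, hpq, hpqs, h⟩ := exists_Ioo_forall_zero_or_forall_ne hst
    (fun τ hτ => (hx τ (hsub hτ)).continuousAt.continuousWithinAt)
  obtain ⟨τ, hτ⟩ := exists_between hpq
  have hτ' := hsub (hpqs hτ)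
  refine ⟨τ, hpqs hτ, (oppositeNeighbours_of_mulVec hn (hA τ hτ') (hne τ hτ') fun i hi => ?_).mem_lyapDomain⟩
  rcases h i with h0 | h0
  · have h1 : (fun σ => x σ i) =ᶠ[𝓝 τ] fun _ => 0 := by
      filter_upwards [Ioo_mem_nhds hτ.1 hτ.2] with σ hσ using h0 σ hσ
    exact (hasDerivAt_pi.1 (hx τ hτ') i).unique ((hasDerivAt_const τ (0 : ℝ)).congr_of_eventuallyEq h1)
  · exact absurd hi (h0 τ hτ)

/-- The solution operators of negative feedback systems do not increase the number of sign changes,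
and make it well defined. -/
theorem lyapMax_le_lyapMin_of_isSolutionOperator (hn : 3 ≤ n)
    (hcont : ContinuousOn A (realIoo α β)) (hA : ∀ τ ∈ realIoo α β, A τ ∈ MMinus n) {s t : ℝ}
    (hs : s ∈ realIoo α β) (ht : t ∈ realIoo α β) (hst : s < t)
    {S : (Fin n → ℝ) →ₗ[ℝ] (Fin n → ℝ)} (hS : IsSolutionOperator α β A s t S)
    {v : Fin n → ℝ} (hv : v ≠ 0) : lyapMax (S v) ≤ lyapMin v := by
  obtain ⟨x, hx, rfl⟩ := hS.exists_solution v
  have hne : ∀ τ ∈ realIoo α β, x τ ≠ 0 := by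
    intro τ hτ h0
    have hzero : IsLinearSolution α β A 0 := fun σ _ => by
      simp only [Pi.zero_apply, Matrix.mulVec_zero]
      exact hasDerivAt_const σ (0 : Fin n → ℝ)
    exact hv (hx.eqOn hcont hzero hτ h0 hs)
  obtain ⟨τ, hτ, hdom⟩ := exists_mem_lyapDomain_of_isLinearSolution hn hA hx hne hs ht hst
  have hτ' : τ ∈ realIoo α β := Icc_subset_realIoo hs ht (Ioo_subset_Icc_self hτ)
  obtain ⟨T, hT⟩ := exists_isSolutionOperator hcont hs hτ'
  obtain ⟨U, hU⟩ := exists_isSolutionOperator hcont hτ' ht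
  obtain ⟨U', hU'⟩ := exists_isSolutionOperator hcont ht hτ'
  have h1 : lyapMin (x τ) ≤ lyapMin (x s) := by
    rw [← hT.map_solution x hx]
    exact lyapMin_antitone_of_isSolutionOperator hn hcont hA hs hτ' hτ.1.le hT _
  rw [hS.map_solution x hx]
  refine le_trans ?_ h1
  -- `U'` runs time backwards from `t` to `τ`. Vectors near `x t` thus come from vectors near `x τ`,
  -- where `N_M` is at most the single value at `x τ`. A `y` near `x t` with `N y = N_M (x t)`
  -- transfers the bound.
  have hlim : ∀ᶠ y in 𝓝 (x t), lyapMax (U' y) ≤ lyapMax (x τ) := by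
    have hc : Tendsto U' (𝓝 (x t)) (𝓝 (x τ)) := by
      have := (LinearMap.continuous_of_finiteDimensional U').tendsto (x t)
      rwa [hU'.map_solution x hx] at this
    exact hc.eventually (eventually_lyapMax_le (x τ))
  have hfreq : ∃ᶠ y in 𝓝[nonvanishing n] (x t), signChanges y = lyapMax (x t) :=
    lyapMax_mem (x t)
  obtain ⟨y, ⟨hy1, hy2⟩, hy3⟩ := ((hfreq.and_eventually (hlim.filter_mono nhdsWithin_le_nhds)
    ).and_eventually self_mem_nhdsWithin).exists
  rw [← hy1, ← lyapMin_of_nonvanishing hy3, ← hU'.symm_apply hU y]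
  refine (lyapMin_antitone_of_isSolutionOperator hn hcont hA hτ' ht hτ.2.le hU _).trans ?_
  exact (lyapMin_le_lyapMax _).trans (hy2.trans (le_of_eq hdom.symm))

end Flow

/-! ### Powers of a linear operator along an ultrafilter -/

section LinearPowers

open Module.End Asymptotics

theorem Submodule.exists_finset_sum_of_mem_biSup {R ι E : Type*} [Ring R] [AddCommGroup E]
    [Module R E] {p : ι → Submodule R E} {Λ : Set ι} {z : E} (hz : z ∈ ⨆ i ∈ Λ, p i) :
    ∃ s : Finset ι, ↑s ⊆ Λ ∧ ∃ f : ι → E, (∀ i ∈ s, f i ∈ p i ∧ f i ≠ 0) ∧ ∑ i ∈ s, f i = z := by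
  obtain ⟨f, hf, rfl⟩ := (Submodule.mem_iSup_iff_exists_finsupp _ _).1 hz
  have h1 : ∀ i ∈ f.support, i ∈ Λ := by
    intro i hi
    by_contra hcon
    have := hf i
    simp only [hcon, iSup_false, Submodule.mem_bot] at this
    exact Finsupp.mem_support_iff.1 hi this
  refine ⟨f.support, h1, f, fun i hi => ⟨?_, Finsupp.mem_support_iff.1 hi⟩, rfl⟩
  have := hf i
  simpa only [h1 i hi, iSup_pos] using this

theorem Submodule.eq_zero_of_sum_eq_zero_of_iSupIndep {R ι E : Type*} [Ring R] [AddCommGroup E]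
    [Module R E] {p : ι → Submodule R E} (hp : iSupIndep p) {s : Finset ι} {f : ι → E}
    (hf : ∀ i ∈ s, f i ∈ p i) (h : ∑ i ∈ s, f i = 0) {i : ι} (hi : i ∈ s) : f i = 0 := by
  classical
  refine (Submodule.disjoint_def.1 (hp i)) _ (hf i hi) ?_
  rw [← Finset.add_sum_erase _ _ hi] at h
  rw [eq_neg_of_add_eq_zero_left h]
  refine Submodule.neg_mem _ (Submodule.sum_mem _ fun j hj => ?_)
  have hj' := Finset.mem_erase.1 hj
  exact Submodule.mem_iSup_of_mem j (Submodule.mem_iSup_of_mem hj'.1 (hf j hj'.2))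

/-- The powers of finitely many complex numbers of modulus one are simultaneously recurrent. -/
theorem exists_ultrafilter_tendsto_pow_one (s : Finset ℂ) (hs : ∀ μ ∈ s, μ ≠ 0) :
    ∃ U : Ultrafilter ℕ, ↑U ≤ (atTop : Filter ℕ) ∧
      ∀ μ ∈ s, Tendsto (fun k : ℕ => (μ / ‖μ‖) ^ k) U (𝓝 1) := by
  have hmem : ∀ μ : s, ((μ : ℂ) / ‖(μ : ℂ)‖) ∈ Submonoid.unitSphere ℂ := by
    intro μ
    have : ‖(μ : ℂ)‖ ≠ 0 := norm_ne_zero_iff.2 (hs μ μ.2)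
    rw [Submonoid.unitSphere, ← SetLike.mem_coe]
    simp [this]
  let g : s → Circle := fun μ => ⟨(μ : ℂ) / ‖(μ : ℂ)‖, hmem μ⟩
  -- In a compact group, here a finite power of the circle, the identity is a cluster point of the
  -- powers of any element.
  obtain ⟨U, hU, hlim⟩ := mapClusterPt_iff_ultrafilter.1 (mapClusterPt_one_atTop_pow g)
  refine ⟨U, hU, fun μ hμ => ?_⟩
  have h1 := (tendsto_pi_nhds.1 hlim ⟨μ, hμ⟩)
  have h2 := (((by fun_prop : Continuous fun c : Circle => (c : ℂ))).tendsto _).comp h1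
  simpa [Function.comp_def, g] using! h2

theorem tendsto_choose_div_choose_of_lt {j d : ℕ} (h : j < d) :
    Tendsto (fun k : ℕ => (k.choose j : ℝ) / k.choose d) atTop (𝓝 0) := by
  refine IsLittleO.tendsto_div_nhds_zero ?_
  refine (isTheta_choose j).isBigO.trans_isLittleO (IsLittleO.trans_isBigO ?_
    (isTheta_choose d).symm.isBigO)
  exact (isLittleO_pow_pow_atTop_of_lt h).comp_tendsto tendsto_natCast_atTop_atTop

theorem tendsto_choose_div_choose_mul_pow {q : ℝ} (hq0 : 0 ≤ q) (hq : q < 1) (j d : ℕ) :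
    Tendsto (fun k : ℕ => (k.choose j : ℝ) / k.choose d * q ^ k) atTop (𝓝 0) := by
  refine squeeze_zero' (Eventually.of_forall fun k => by positivity) ?_
    (tendsto_pow_const_mul_const_pow_of_lt_one j hq0 hq)
  filter_upwards [eventually_ge_atTop d] with k hk
  refine mul_le_mul_of_nonneg_right ?_ (pow_nonneg hq0 k)
  have h1 : (1 : ℝ) ≤ k.choose d := by exact_mod_cast Nat.choose_pos hk
  refine (div_le_self (by positivity) h1).trans ?_
  exact_mod_cast Nat.choose_le_pow k j

variable {E : Type*} [NormedAddCommGroup E] [NormedSpace ℂ E]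

theorem pow_apply_of_mem_eigenspace {T : Module.End ℂ E} {μ : ℂ} {z : E}
    (hz : z ∈ eigenspace T μ) (k : ℕ) : (T ^ k) z = μ ^ k • z := by
  induction k with
  | zero => simp
  | succ k ih => rw [pow_succ', Module.End.mul_apply, ih, map_smul, mem_eigenspace_iff.1 hz,
      smul_smul, pow_succ]

theorem ne_zero_of_mem_maxGenEigenspace {T : Module.End ℂ E} (hT : Function.Injective T) {μ : ℂ}
    {z : E} (hz : z ∈ maxGenEigenspace T μ) (hz0 : z ≠ 0) : μ ≠ 0 := by
  rintro rfl
  obtain ⟨k, hk⟩ := (mem_maxGenEigenspace T 0 z).1 hz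
  rw [zero_smul, sub_zero, Module.End.pow_apply] at hk
  exact hz0 (hT.iterate k (by rw [hk, ← Module.End.pow_apply, map_zero]))

/-- Vectors that are sums of eigenvectors to eigenvalues of the same modulus are recurrent. -/
theorem exists_ultrafilter_recurrent {T : Module.End ℂ E} {r : ℝ} (hr : 0 < r) {z : E}
    (hz : z ∈ ⨆ μ ∈ {μ : ℂ | ‖μ‖ = r}, eigenspace T μ) :
    ∃ U : Ultrafilter ℕ, ↑U ≤ (atTop : Filter ℕ) ∧
      Tendsto (fun k : ℕ => ((r ^ k)⁻¹ : ℝ) • (T ^ k) z) U (𝓝 z) := by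
  obtain ⟨s, hs, f, hf, rfl⟩ := Submodule.exists_finset_sum_of_mem_biSup hz
  have hs0 : ∀ μ ∈ s, μ ≠ 0 := fun μ hμ => norm_ne_zero_iff.1 (by rw [hs hμ]; exact hr.ne')
  obtain ⟨U, hU, hlim⟩ := exists_ultrafilter_tendsto_pow_one s hs0
  refine ⟨U, hU, ?_⟩
  have h1 : (fun k : ℕ => ((r ^ k)⁻¹ : ℝ) • (T ^ k) (∑ μ ∈ s, f μ)) =
      fun k : ℕ => ∑ μ ∈ s, (μ / ‖μ‖) ^ k • f μ := by
    ext k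
    rw [map_sum, Finset.smul_sum]
    refine Finset.sum_congr rfl fun μ hμ => ?_
    rw [pow_apply_of_mem_eigenspace (hf μ hμ).1, hs hμ, ← Complex.coe_smul, smul_smul, div_pow,
      div_eq_inv_mul]
    push_cast
    rfl
  rw [h1]
  refine tendsto_finsetSum _ fun μ hμ => ?_
  simpa using (hlim μ hμ).smul_const (f μ)

/-- Sums of eigenvectors to eigenvalues of modulus `r` grow slower than `R ^ k` for `R > r`. -/
theorem tendsto_pow_apply_zero {T : Module.End ℂ E} {r R : ℝ} (hr : 0 < r) (hR : r < R) {z : E}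
    (hz : z ∈ ⨆ μ ∈ {μ : ℂ | ‖μ‖ = r}, eigenspace T μ) :
    Tendsto (fun k : ℕ => ((R ^ k)⁻¹ : ℝ) • (T ^ k) z) atTop (𝓝 0) := by
  obtain ⟨s, hs, f, hf, rfl⟩ := Submodule.exists_finset_sum_of_mem_biSup hz
  have hR0 : 0 < R := hr.trans hR
  have h1 : (fun k : ℕ => ((R ^ k)⁻¹ : ℝ) • (T ^ k) (∑ μ ∈ s, f μ)) =
      fun k : ℕ => ∑ μ ∈ s, (μ / R) ^ k • f μ := by
    ext k
    rw [map_sum, Finset.smul_sum]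
    refine Finset.sum_congr rfl fun μ hμ => ?_
    rw [pow_apply_of_mem_eigenspace (hf μ hμ).1, ← Complex.coe_smul, smul_smul, div_pow,
      div_eq_inv_mul]
    push_cast
    rfl
  rw [h1, ← Finset.sum_const_zero (s := s)]
  refine tendsto_finsetSum _ fun μ hμ => ?_
  have h2 : ‖μ / (R : ℂ)‖ < 1 := by
    rw [norm_div, hs hμ, Complex.norm_real, Real.norm_of_nonneg hR0.le, div_lt_one hR0]
    exact hR
  simpa using (tendsto_pow_atTop_nhds_zero_of_norm_lt_one h2).smul_const (f μ)

/-- The binomial expansion in the nilpotent part. The number of terms does not depend on `k`, which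
allows a limit term by term. -/
theorem pow_apply_eq_sum_choose (T : Module.End ℂ E) (μ : ℂ) {z : E} {K : ℕ}
    (hK : ((T - μ • (1 : Module.End ℂ E)) ^ K) z = 0) {k : ℕ} (hk : K ≤ k) :
    (T ^ k) z = ∑ j ∈ Finset.range K,
      ((k.choose j : ℂ) * μ ^ (k - j)) • ((T - μ • (1 : Module.End ℂ E)) ^ j) z := by
  set N := T - μ • (1 : Module.End ℂ E) with hN
  have hT : T = N + μ • (1 : Module.End ℂ E) := by rw [hN, sub_add_cancel]
  have hcomm : Commute N (μ • (1 : Module.End ℂ E)) := (Commute.one_right N).smul_right μ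
  have h1 : (T ^ k) z = ∑ j ∈ Finset.range (k + 1),
      ((k.choose j : ℂ) * μ ^ (k - j)) • (N ^ j) z := by
    rw [hT, hcomm.add_pow, LinearMap.sum_apply]
    refine Finset.sum_congr rfl fun j _ => ?_
    rw [smul_pow, one_pow, mul_smul_comm, mul_one, ← nsmul_eq_mul', LinearMap.smul_apply,
      LinearMap.smul_apply, ← Nat.cast_smul_eq_nsmul ℂ, smul_smul]
  rw [h1]
  symm
  refine Finset.sum_subset (Finset.range_mono (by omega)) fun j _ hj => ?_
  have hj' : K ≤ j := not_lt.1 fun h => hj (Finset.mem_range.2 h)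
  obtain ⟨i, rfl⟩ := Nat.exists_eq_add_of_le' hj'
  rw [pow_add, Module.End.mul_apply, hK, map_zero, smul_zero]

/-- The normalized powers of an operator, applied to a vector, have a limit point that is a sum of
eigenvectors to eigenvalues of the same modulus. -/
theorem exists_ultrafilter_tendsto_eigenvectors {T : Module.End ℂ E} (hT : Function.Injective T)
    {Λ : Set ℂ} {z : E} (hz : z ∈ ⨆ μ ∈ Λ, maxGenEigenspace T μ) (hz0 : z ≠ 0) :
    ∃ U : Ultrafilter ℕ, ↑U ≤ (atTop : Filter ℕ) ∧ ∃ a : ℕ → ℝ, (∀ᶠ k in U, a k ≠ 0) ∧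
      ∃ μ₀ ∈ Λ, μ₀ ≠ 0 ∧ ∃ y ∈ ⨆ μ ∈ {μ : ℂ | ‖μ‖ = ‖μ₀‖}, eigenspace T μ, y ≠ 0 ∧
        Tendsto (fun k : ℕ => a k • (T ^ k) z) U (𝓝 y) := by
  classical
  obtain ⟨s, hs, f, hf, rfl⟩ := Submodule.exists_finset_sum_of_mem_biSup hz
  have hs0 : ∀ μ ∈ s, μ ≠ 0 := fun μ hμ => ne_zero_of_mem_maxGenEigenspace hT (hf μ hμ).1 (hf μ hμ).2
  have hsne : s.Nonempty := Finset.nonempty_iff_ne_empty.2 fun h => hz0 (by rw [h]; simp)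
  obtain ⟨U, hU, hlim⟩ := exists_ultrafilter_tendsto_pow_one s hs0
  have hnil : ∀ μ ∈ s, ∃ d, ((T - μ • (1 : Module.End ℂ E)) ^ d) (f μ) ≠ 0 ∧
      ((T - μ • (1 : Module.End ℂ E)) ^ (d + 1)) (f μ) = 0 := by
    intro μ hμ
    have h1 := (mem_maxGenEigenspace T μ _).1 (hf μ hμ).1
    have h2 : Nat.find h1 ≠ 0 := by
      intro h0
      have := Nat.find_spec h1
      rw [h0, pow_zero, Module.End.one_apply] at this
      exact (hf μ hμ).2 this
    refine ⟨Nat.find h1 - 1, Nat.find_min h1 (by omega), ?_⟩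
    rw [Nat.sub_add_cancel (by omega)]
    exact Nat.find_spec h1
  choose! D hD hD' using hnil
  have hD'' : ∀ μ ∈ s, ∀ j, D μ < j → ((T - μ • (1 : Module.End ℂ E)) ^ j) (f μ) = 0 := by
    intro μ hμ j hj
    obtain ⟨i, rfl⟩ := Nat.exists_eq_add_of_lt hj
    rw [show D μ + i + 1 = i + (D μ + 1) by ring, pow_add, Module.End.mul_apply, hD' μ hμ, map_zero]
  obtain ⟨μ₁, hμ₁, hmax⟩ := s.exists_max_image (fun μ => ‖μ‖) hsne
  -- The dominant growth is `r ^ k * k.choose d`: `r` is the largest modulus present, and `d` the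
  -- largest nilpotency height among components of that modulus.
  set r := ‖μ₁‖ with hr
  have hr0 : 0 < r := norm_pos_iff.2 (hs0 μ₁ hμ₁)
  obtain ⟨μ₀, hμ₀, hmaxD⟩ := (s.filter fun μ => ‖μ‖ = r).exists_max_image D
    ⟨μ₁, Finset.mem_filter.2 ⟨hμ₁, rfl⟩⟩
  rw [Finset.mem_filter] at hμ₀
  set d := D μ₀ with hd
  obtain ⟨K, hK⟩ : ∃ K, ∀ μ ∈ s, D μ < K :=
    ⟨s.sup D + 1, fun μ hμ => Nat.lt_succ_of_le (Finset.le_sup hμ)⟩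
  have hcoef : ∀ μ ∈ s, ∀ j, (‖μ‖ < r ∨ (‖μ‖ = r ∧ j < d)) →
      Tendsto (fun k : ℕ => (((r ^ k * k.choose d : ℝ)⁻¹ : ℝ) : ℂ) *
        ((k.choose j : ℂ) * μ ^ (k - j))) atTop (𝓝 0) := by
    intro μ hμ j hj
    rw [tendsto_zero_iff_norm_tendsto_zero]
    have h1 : Tendsto (fun k : ℕ => (k.choose j : ℝ) / k.choose d * (‖μ‖ / r) ^ k) atTop (𝓝 0) := by
      rcases hj with hj | ⟨hj, hj'⟩
      · exact tendsto_choose_div_choose_mul_pow (by positivity) ((div_lt_one hr0).2 hj) j d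
      · simpa [hj, hr0.ne'] using tendsto_choose_div_choose_of_lt hj'
    have h2 := h1.mul_const ((‖μ‖ ^ j)⁻¹)
    rw [zero_mul] at h2
    refine h2.congr' ?_
    filter_upwards [eventually_ge_atTop j] with k hk
    have hμ0 : ‖μ‖ ≠ 0 := norm_ne_zero_iff.2 (hs0 μ hμ)
    rw [norm_mul, norm_mul, norm_pow, Complex.norm_real, Complex.norm_natCast, norm_inv,
      Real.norm_of_nonneg (by positivity), pow_sub₀ _ hμ0 hk, mul_inv, div_pow]
    ring
  have hterm : ∀ μ ∈ s, ∀ j ∈ Finset.range K,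
      Tendsto (fun k : ℕ => ((((r ^ k * k.choose d : ℝ)⁻¹ : ℝ) : ℂ) *
        ((k.choose j : ℂ) * μ ^ (k - j))) • ((T - μ • (1 : Module.End ℂ E)) ^ j) (f μ)) U
        (𝓝 (if ‖μ‖ = r ∧ j = d then
          (μ ^ d)⁻¹ • ((T - μ • (1 : Module.End ℂ E)) ^ d) (f μ) else 0)) := by
    intro μ hμ j _
    by_cases hcase : ‖μ‖ < r ∨ (‖μ‖ = r ∧ j < d)
    · rw [if_neg (by
        rintro ⟨h1, h2⟩
        rcases hcase with h | ⟨_, h⟩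
        · exact h.ne h1
        · exact h.ne h2)]
      simpa using ((hcoef μ hμ j hcase).mono_left hU).smul_const
        (((T - μ • (1 : Module.End ℂ E)) ^ j) (f μ))
    · have hμr : ‖μ‖ = r := le_antisymm (hmax μ hμ) (not_lt.1 fun h => hcase (Or.inl h))
      have hjd : d ≤ j := not_lt.1 fun h => hcase (Or.inr ⟨hμr, h⟩)
      rcases hjd.eq_or_lt with rfl | hlt
      · rw [if_pos ⟨hμr, rfl⟩]
        refine Tendsto.smul_const ?_ _
        have h1 := (hlim μ hμ).mul_const ((μ ^ d)⁻¹)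
        rw [one_mul] at h1
        refine h1.congr' ((eventually_ge_atTop d).filter_mono hU |>.mono fun k hk => ?_)
        have hc : ((k.choose d : ℕ) : ℂ) ≠ 0 := by exact_mod_cast (Nat.choose_pos hk).ne'
        have hrc : ((r : ℝ) : ℂ) ≠ 0 := by exact_mod_cast hr0.ne'
        beta_reduce
        rw [hμr, pow_sub₀ _ (hs0 μ hμ) hk, div_pow]
        push_cast
        field_simp
      · rw [if_neg fun h => hlt.ne' h.2, hD'' μ hμ j
          ((hmaxD μ (Finset.mem_filter.2 ⟨hμ, hμr⟩)).trans_lt hlt)]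
        simp
  have hker : ∀ μ ∈ s, ‖μ‖ = r →
      (μ ^ d)⁻¹ • ((T - μ • (1 : Module.End ℂ E)) ^ d) (f μ) ∈ eigenspace T μ := by
    intro μ hμ hμr
    refine Submodule.smul_mem _ _ ?_
    have h1 := hD'' μ hμ (d + 1) (Nat.lt_succ_of_le (hmaxD μ (Finset.mem_filter.2 ⟨hμ, hμr⟩)))
    rw [pow_succ', Module.End.mul_apply] at h1
    rw [mem_eigenspace_iff]
    simpa [sub_eq_zero] using h1
  refine ⟨U, hU, fun k => (r ^ k * k.choose d)⁻¹, ?_, μ₀, hs hμ₀.1, hs0 _ hμ₀.1,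
    ∑ μ ∈ s.filter (fun μ => ‖μ‖ = r),
      (μ ^ d)⁻¹ • ((T - μ • (1 : Module.End ℂ E)) ^ d) (f μ), ?_, ?_, ?_⟩
  · filter_upwards [(eventually_ge_atTop d).filter_mono hU] with k hk
    have : (k.choose d : ℝ) ≠ 0 := by exact_mod_cast (Nat.choose_pos hk).ne'
    positivity
  · refine Submodule.sum_mem _ fun μ hμ => ?_
    rw [Finset.mem_filter] at hμ
    refine Submodule.mem_iSup_of_mem μ (Submodule.mem_iSup_of_mem ?_ (hker μ hμ.1 hμ.2))
    rw [mem_ofPred_eq, hμ.2, hμ₀.2]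
  -- The summand for `μ₀` is nonzero by the choice of `d`, and eigenspaces are independent, so the
  -- limit does not vanish.
  · intro h0
    have h1 := Submodule.eq_zero_of_sum_eq_zero_of_iSupIndep (eigenspaces_iSupIndep T)
      (fun μ hμ => hker μ (Finset.mem_filter.1 hμ).1 (Finset.mem_filter.1 hμ).2) h0
      (Finset.mem_filter.2 hμ₀)
    rw [smul_eq_zero] at h1
    rcases h1 with h1 | h1
    · exact inv_ne_zero (pow_ne_zero _ (hs0 _ hμ₀.1)) h1
    · exact hD μ₀ hμ₀.1 h1
  · have hsum := tendsto_finsetSum s fun μ hμ =>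
      tendsto_finsetSum (Finset.range K) fun j hj => hterm μ hμ j hj
    have hlimit : ∑ μ ∈ s, ∑ j ∈ Finset.range K, (if ‖μ‖ = r ∧ j = d then
          (μ ^ d)⁻¹ • ((T - μ • (1 : Module.End ℂ E)) ^ d) (f μ) else 0) =
        ∑ μ ∈ s.filter (fun μ => ‖μ‖ = r),
          (μ ^ d)⁻¹ • ((T - μ • (1 : Module.End ℂ E)) ^ d) (f μ) := by
      rw [Finset.sum_filter]
      refine Finset.sum_congr rfl fun μ hμ => ?_
      by_cases h : ‖μ‖ = r
      · simp only [h, true_and, if_true]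
        rw [Finset.sum_ite_eq', if_pos (Finset.mem_range.2 (hK μ₀ hμ₀.1))]
      · simp [h]
    rw [hlimit] at hsum
    refine hsum.congr' ((eventually_ge_atTop K).filter_mono hU |>.mono fun k hk => ?_)
    beta_reduce
    rw [map_sum, Finset.smul_sum]
    refine Finset.sum_congr rfl fun μ hμ => ?_
    rw [pow_apply_eq_sum_choose T μ (hD'' μ hμ K (hK μ hμ)) hk, Finset.smul_sum]
    refine Finset.sum_congr rfl fun j _ => ?_
    rw [← Complex.coe_smul, smul_smul]

/-- The generalized eigenspaces of the inverse. -/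
theorem maxGenEigenspace_le_of_comp_eq_one {T T' : Module.End ℂ E} (h : T * T' = 1)
    (h' : T' * T = 1) {μ : ℂ} (hμ : μ ≠ 0) :
    maxGenEigenspace T μ ≤ maxGenEigenspace T' μ⁻¹ := by
  intro z hz
  obtain ⟨k, hk⟩ := (mem_maxGenEigenspace T μ z).1 hz
  refine (mem_maxGenEigenspace T' μ⁻¹ z).2 ⟨k, ?_⟩
  -- `T' - μ⁻¹ = -μ⁻¹ T' (T - μ)` with commuting factors, so powers killing `z` for `T` also kill it
  -- for `T'`.
  have e : T' - μ⁻¹ • (1 : Module.End ℂ E) =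
      ((-μ⁻¹) • T') * (T - μ • (1 : Module.End ℂ E)) := by
    rw [smul_mul_assoc, mul_sub, h', mul_smul_comm, mul_one, smul_sub, smul_smul]
    simp [hμ, sub_eq_add_neg, add_comm]
  have hc : Commute ((-μ⁻¹) • T') (T - μ • (1 : Module.End ℂ E)) := by
    refine Commute.smul_left (Commute.sub_right ?_ ((Commute.one_right T').smul_right μ)) _
    exact h'.trans h.symm
  rw [e, hc.mul_pow, Module.End.mul_apply, hk, map_zero]

theorem eigenspace_le_of_comp_eq_one {T T' : Module.End ℂ E} (h' : T' * T = 1) {μ : ℂ}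
    (hμ : μ ≠ 0) : eigenspace T μ ≤ eigenspace T' μ⁻¹ := by
  intro z hz
  rw [mem_eigenspace_iff] at hz ⊢
  have h1 : T' (T z) = z := by rw [← Module.End.mul_apply, h', Module.End.one_apply]
  rw [hz, map_smul] at h1
  rw [← h1, smul_smul, inv_mul_cancel₀ hμ, one_smul, h1]

end LinearPowers

/-! ### Complexification -/

section Complexification

open Module.End

variable {n : ℕ}

/-- The inclusion of real into complex vectors. -/
noncomputable def realToComplex (n : ℕ) : (Fin n → ℝ) →ₗ[ℝ] (Fin n → ℂ) where
  toFun x i := x i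
  map_add' x y := by ext; simp
  map_smul' c x := by ext; simp

/-- The real part of a complex vector. -/
noncomputable def rePart (n : ℕ) : (Fin n → ℂ) →ₗ[ℝ] (Fin n → ℝ) where
  toFun z i := (z i).re
  map_add' x y := by ext; simp
  map_smul' c x := by ext; simp

/-- The imaginary part of a complex vector. -/
noncomputable def imPart (n : ℕ) : (Fin n → ℂ) →ₗ[ℝ] (Fin n → ℝ) where
  toFun z i := (z i).im
  map_add' x y := by ext; simp
  map_smul' c x := by ext; simp

theorem complexVector_ext {z w : Fin n → ℂ} (h : rePart n z = rePart n w)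
    (h' : imPart n z = imPart n w) : z = w :=
  funext fun i => Complex.ext (congrFun h i) (congrFun h' i)

@[simp]
theorem rePart_realToComplex (x : Fin n → ℝ) : rePart n (realToComplex n x) = x := by
  ext i
  simp [rePart, realToComplex]

@[simp]
theorem imPart_realToComplex (x : Fin n → ℝ) : imPart n (realToComplex n x) = 0 := by
  ext i
  simp [imPart, realToComplex]

theorem realToComplex_injective (n : ℕ) : Function.Injective (realToComplex n) := fun x y h => by
  rw [← rePart_realToComplex x, h, rePart_realToComplex]

theorem continuous_rePart (n : ℕ) : Continuous (rePart n) :=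
  continuous_pi fun i => Complex.continuous_re.comp (continuous_apply i)

theorem continuous_imPart (n : ℕ) : Continuous (imPart n) :=
  continuous_pi fun i => Complex.continuous_im.comp (continuous_apply i)

/-- The complex linear extension of a real operator. -/
noncomputable def complexify (S : Module.End ℝ (Fin n → ℝ)) : Module.End ℂ (Fin n → ℂ) :=
  Matrix.toLin' ((LinearMap.toMatrix' S).map ((↑) : ℝ → ℂ))

@[simp]
theorem rePart_complexify (S : Module.End ℝ (Fin n → ℝ)) (z : Fin n → ℂ) :
    rePart n (complexify S z) = S (rePart n z) := by
  ext i
  rw [← LinearMap.toMatrix'_mulVec S]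
  simp [rePart, complexify, Matrix.toLin'_apply, Matrix.mulVec, dotProduct]

@[simp]
theorem imPart_complexify (S : Module.End ℝ (Fin n → ℝ)) (z : Fin n → ℂ) :
    imPart n (complexify S z) = S (imPart n z) := by
  ext i
  rw [← LinearMap.toMatrix'_mulVec S]
  simp [imPart, complexify, Matrix.toLin'_apply, Matrix.mulVec, dotProduct]

theorem complexify_realToComplex (S : Module.End ℝ (Fin n → ℝ)) (x : Fin n → ℝ) :
    complexify S (realToComplex n x) = realToComplex n (S x) :=
  complexVector_ext (by simp) (by simp)

theorem complexify_pow_realToComplex (S : Module.End ℝ (Fin n → ℝ)) (k : ℕ) (x : Fin n → ℝ) :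
    (complexify S ^ k) (realToComplex n x) = realToComplex n ((S ^ k) x) := by
  induction k with
  | zero => simp
  | succ k ih => rw [pow_succ', Module.End.mul_apply, ih, complexify_realToComplex, pow_succ',
      Module.End.mul_apply]

theorem complexify_mul_eq_one {S S' : Module.End ℝ (Fin n → ℝ)} (h : S * S' = 1) :
    complexify S * complexify S' = 1 := by
  have h1 : ∀ x, S (S' x) = x := fun x => by
    rw [← Module.End.mul_apply, h, Module.End.one_apply]
  refine LinearMap.ext fun z => complexVector_ext ?_ ?_ <;> simp [h1]

theorem complexify_injective {S : Module.End ℝ (Fin n → ℝ)} (h : Function.Injective S) :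
    Function.Injective (complexify S) := fun z w hzw =>
  complexVector_ext (h (by rw [← rePart_complexify, hzw, rePart_complexify]))
    (h (by rw [← imPart_complexify, hzw, imPart_complexify]))

theorem complexify_star (S : Module.End ℝ (Fin n → ℝ)) (z : Fin n → ℂ) :
    complexify S (star z) = star (complexify S z) := by
  have hre : ∀ w : Fin n → ℂ, rePart n (star w) = rePart n w := fun w => by ext; simp [rePart]
  have him : ∀ w : Fin n → ℂ, imPart n (star w) = -imPart n w := fun w => by ext; simp [imPart]
  refine complexVector_ext ?_ ?_
  · rw [rePart_complexify, hre, hre, rePart_complexify]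
  · rw [imPart_complexify, him, him, imPart_complexify, map_neg]

theorem star_mem_eigenspace {S : Module.End ℝ (Fin n → ℝ)} {μ : ℂ} {z : Fin n → ℂ}
    (hz : z ∈ eigenspace (complexify S) μ) : star z ∈ eigenspace (complexify S) (star μ) := by
  rw [mem_eigenspace_iff] at hz ⊢
  rw [complexify_star, hz, star_smul]

theorem star_mem_maxGenEigenspace {S : Module.End ℝ (Fin n → ℝ)} {μ : ℂ} {z : Fin n → ℂ}
    (hz : z ∈ maxGenEigenspace (complexify S) μ) :
    star z ∈ maxGenEigenspace (complexify S) (star μ) := by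
  rw [mem_maxGenEigenspace] at hz ⊢
  obtain ⟨k, hk⟩ := hz
  refine ⟨k, ?_⟩
  have key : ∀ k, ((complexify S - star μ • (1 : Module.End ℂ (Fin n → ℂ))) ^ k) (star z) =
      star (((complexify S - μ • (1 : Module.End ℂ (Fin n → ℂ))) ^ k) z) := by
    intro k
    induction k with
    | zero => simp
    | succ k ih =>
      rw [pow_succ', Module.End.mul_apply, ih, pow_succ', Module.End.mul_apply]
      simp [complexify_star, LinearMap.sub_apply, star_smul]
  rw [key, hk, star_zero]

/-- Real and imaginary parts are combinations of `z` and its conjugate, and a conjugation-stable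
family of subspaces contains both. Real vectors are extracted from complex eigenspaces in this way.
-/
theorem realToComplex_rePart_mem {p : ℂ → Submodule ℂ (Fin n → ℂ)}
    (hp : ∀ μ, ∀ z ∈ p μ, star z ∈ p (star μ)) {Λ : Set ℂ} (hΛ : ∀ μ ∈ Λ, star μ ∈ Λ)
    {z : Fin n → ℂ} (hz : z ∈ ⨆ μ ∈ Λ, p μ) :
    realToComplex n (rePart n z) ∈ ⨆ μ ∈ Λ, p μ ∧ realToComplex n (imPart n z) ∈ ⨆ μ ∈ Λ, p μ := by
  have hstar : star z ∈ ⨆ μ ∈ Λ, p μ := by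
    obtain ⟨s, hs, f, hf, rfl⟩ := Submodule.exists_finset_sum_of_mem_biSup hz
    rw [star_sum]
    exact Submodule.sum_mem _ fun μ hμ => Submodule.mem_iSup_of_mem (star μ)
      (Submodule.mem_iSup_of_mem (hΛ μ (hs hμ)) (hp μ _ (hf μ hμ).1))
  have h1 : realToComplex n (rePart n z) = (1 / 2 : ℂ) • (z + star z) := by
    refine funext fun i => Complex.ext ?_ ?_ <;> simp [realToComplex, rePart]
    ring
  have h2 : realToComplex n (imPart n z) = (-Complex.I / 2 : ℂ) • (z - star z) := by
    refine funext fun i => Complex.ext ?_ ?_ <;> simp [realToComplex, imPart]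
    ring
  rw [h1, h2]
  exact ⟨Submodule.smul_mem _ _ (Submodule.add_mem _ hz hstar),
    Submodule.smul_mem _ _ (Submodule.sub_mem _ hz hstar)⟩

/-- The real vectors in the sum of the complex generalized eigenspaces to given eigenvalues. -/
noncomputable def spectralSubspace (S : Module.End ℝ (Fin n → ℝ)) (Λ : Set ℂ) : Submodule ℝ (Fin n → ℝ) :=
  ((⨆ μ ∈ Λ, maxGenEigenspace (complexify S) μ).restrictScalars ℝ).comap (realToComplex n)

/-- The real vectors in the sum of the complex eigenspaces to eigenvalues of modulus `r`. -/
noncomputable def modulusEigenspace (S : Module.End ℝ (Fin n → ℝ)) (r : ℝ) : Submodule ℝ (Fin n → ℝ) :=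
  ((⨆ μ ∈ {μ : ℂ | ‖μ‖ = r}, eigenspace (complexify S) μ).restrictScalars ℝ).comap
    (realToComplex n)

theorem mem_spectralSubspace {S : Module.End ℝ (Fin n → ℝ)} {Λ : Set ℂ} {x : Fin n → ℝ} :
    x ∈ spectralSubspace S Λ ↔ realToComplex n x ∈ ⨆ μ ∈ Λ, maxGenEigenspace (complexify S) μ :=
  Iff.rfl

theorem mem_modulusEigenspace {S : Module.End ℝ (Fin n → ℝ)} {r : ℝ} {x : Fin n → ℝ} :
    x ∈ modulusEigenspace S r ↔
      realToComplex n x ∈ ⨆ μ ∈ {μ : ℂ | ‖μ‖ = r}, eigenspace (complexify S) μ :=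
  Iff.rfl

theorem apply_mem_biSup {E : Type*} [AddCommGroup E] [Module ℂ E] {T : Module.End ℂ E}
    {p : ℂ → Submodule ℂ E} (hp : ∀ μ, ∀ z ∈ p μ, T z ∈ p μ) {Λ : Set ℂ} {z : E}
    (hz : z ∈ ⨆ μ ∈ Λ, p μ) : T z ∈ ⨆ μ ∈ Λ, p μ := by
  obtain ⟨s, hs, f, hf, rfl⟩ := Submodule.exists_finset_sum_of_mem_biSup hz
  rw [map_sum]
  exact Submodule.sum_mem _ fun μ hμ => Submodule.mem_iSup_of_mem μ
    (Submodule.mem_iSup_of_mem (hs hμ) (hp μ _ (hf μ hμ).1))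

theorem apply_mem_spectralSubspace {S : Module.End ℝ (Fin n → ℝ)} {Λ : Set ℂ} {x : Fin n → ℝ}
    (hx : x ∈ spectralSubspace S Λ) : S x ∈ spectralSubspace S Λ := by
  rw [mem_spectralSubspace] at hx ⊢
  rw [← complexify_realToComplex]
  exact apply_mem_biSup (fun μ _ hz => mapsTo_maxGenEigenspace_of_comm (Commute.refl _) μ hz) hx

theorem apply_mem_modulusEigenspace {S : Module.End ℝ (Fin n → ℝ)} {r : ℝ} {x : Fin n → ℝ}
    (hx : x ∈ modulusEigenspace S r) : S x ∈ modulusEigenspace S r := by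
  rw [mem_modulusEigenspace] at hx ⊢
  rw [← complexify_realToComplex]
  exact apply_mem_biSup (fun μ z hz => by
    rw [mem_eigenspace_iff.1 hz]
    exact Submodule.smul_mem _ _ hz) hx

theorem modulusEigenspace_le_inv {S S' : Module.End ℝ (Fin n → ℝ)} (h : S' * S = 1) {r : ℝ}
    (hr : 0 < r) : modulusEigenspace S r ≤ modulusEigenspace S' r⁻¹ := by
  intro x hx
  rw [mem_modulusEigenspace] at hx ⊢
  refine (iSup₂_le fun μ hμ => ?_ : (⨆ μ ∈ {μ : ℂ | ‖μ‖ = r}, eigenspace (complexify S) μ) ≤ _) hx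
  have hμ : ‖μ‖ = r := hμ
  have hμ0 : μ ≠ 0 := norm_ne_zero_iff.1 (by rw [hμ]; exact hr.ne')
  refine (eigenspace_le_of_comp_eq_one (complexify_mul_eq_one h) hμ0).trans ?_
  exact le_biSup (fun μ => eigenspace (complexify S') μ) (show μ⁻¹ ∈ {μ : ℂ | ‖μ‖ = r⁻¹} by
    rw [mem_ofPred_eq, norm_inv, hμ])

theorem spectralSubspace_le_inv {S S' : Module.End ℝ (Fin n → ℝ)} (h : S * S' = 1)
    (h' : S' * S = 1) (Λ : Set ℂ) :
    spectralSubspace S Λ ≤ spectralSubspace S' {μ | μ⁻¹ ∈ Λ} := by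
  intro x hx
  rw [mem_spectralSubspace] at hx ⊢
  obtain ⟨s, hs, f, hf, hsum⟩ := Submodule.exists_finset_sum_of_mem_biSup hx
  rw [← hsum]
  refine Submodule.sum_mem _ fun μ hμ => ?_
  have hinj : Function.Injective (complexify S) := Function.LeftInverse.injective
    (g := complexify S') fun z => by
      rw [← Module.End.mul_apply, complexify_mul_eq_one h', Module.End.one_apply]
  have hμ0 := ne_zero_of_mem_maxGenEigenspace hinj (hf μ hμ).1 (hf μ hμ).2
  refine Submodule.mem_iSup_of_mem μ⁻¹ (Submodule.mem_iSup_of_mem (by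
    rw [mem_ofPred_eq, inv_inv]; exact hs hμ) ?_)
  exact maxGenEigenspace_le_of_comp_eq_one (complexify_mul_eq_one h) (complexify_mul_eq_one h') hμ0
    (hf μ hμ).1

theorem tendsto_of_tendsto_realToComplex {S : Module.End ℝ (Fin n → ℝ)} {x : Fin n → ℝ}
    {l : Filter ℕ} {a : ℕ → ℝ} {y : Fin n → ℂ}
    (h : Tendsto (fun k => a k • (complexify S ^ k) (realToComplex n x)) l (𝓝 y)) :
    Tendsto (fun k => a k • (S ^ k) x) l (𝓝 (rePart n y)) := by
  have := ((continuous_rePart n).tendsto y).comp h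
  simpa [Function.comp_def, complexify_pow_realToComplex] using! this

theorem exists_ultrafilter_recurrent_real {S : Module.End ℝ (Fin n → ℝ)} {r : ℝ} (hr : 0 < r)
    {x : Fin n → ℝ} (hx : x ∈ modulusEigenspace S r) :
    ∃ U : Ultrafilter ℕ, ↑U ≤ (atTop : Filter ℕ) ∧
      Tendsto (fun k : ℕ => ((r ^ k)⁻¹ : ℝ) • (S ^ k) x) U (𝓝 x) := by
  obtain ⟨U, hU, h⟩ := exists_ultrafilter_recurrent hr hx
  refine ⟨U, hU, ?_⟩
  simpa using tendsto_of_tendsto_realToComplex h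

theorem tendsto_pow_apply_zero_real {S : Module.End ℝ (Fin n → ℝ)} {r R : ℝ} (hr : 0 < r)
    (hR : r < R) {x : Fin n → ℝ} (hx : x ∈ modulusEigenspace S r) :
    Tendsto (fun k : ℕ => ((R ^ k)⁻¹ : ℝ) • (S ^ k) x) atTop (𝓝 0) := by
  simpa using tendsto_of_tendsto_realToComplex (tendsto_pow_apply_zero hr hR hx)

theorem exists_ultrafilter_tendsto_modulusEigenspace {S : Module.End ℝ (Fin n → ℝ)}
    (hS : Function.Injective S) {Λ : Set ℂ} {x : Fin n → ℝ} (hx : x ∈ spectralSubspace S Λ)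
    (hx0 : x ≠ 0) :
    ∃ U : Ultrafilter ℕ, ↑U ≤ (atTop : Filter ℕ) ∧ ∃ a : ℕ → ℝ, (∀ᶠ k in U, a k ≠ 0) ∧
      ∃ μ ∈ Λ, μ ≠ 0 ∧ ∃ y ∈ modulusEigenspace S ‖μ‖, y ≠ 0 ∧
        Tendsto (fun k : ℕ => a k • (S ^ k) x) U (𝓝 y) := by
  have hx0' : realToComplex n x ≠ 0 := fun h => hx0 (realToComplex_injective n (by rw [h, map_zero]))
  obtain ⟨U, hU, a, ha, μ, hμ, hμ0, y, hy, hy0, hlim⟩ :=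
    exists_ultrafilter_tendsto_eigenvectors (complexify_injective hS) hx hx0'
  -- The iterates of a real vector under real scalings are real, hence so is their limit.
  have him : imPart n y = 0 := by
    have h1 := ((continuous_imPart n).tendsto y).comp hlim
    refine tendsto_nhds_unique h1 ?_
    simp [Function.comp_def, complexify_pow_realToComplex]
  have hyre : realToComplex n (rePart n y) = y := complexVector_ext (by simp) (by simp [him])
  refine ⟨U, hU, a, ha, μ, hμ, hμ0, rePart n y, ?_, fun h => hy0 ?_,
    tendsto_of_tendsto_realToComplex hlim⟩
  · rw [mem_modulusEigenspace, hyre]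
    exact hy
  · rw [← hyre, h, map_zero]

end Complexification

/-! ### Discrete Lyapunov functions -/

/-- A pair of lower and upper semicontinuous functions, invariant under scaling, such that the
upper one at the image of a nonzero vector is at most the lower one at the vector. -/
structure DiscreteLyapunov {n : ℕ} (S : Module.End ℝ (Fin n → ℝ)) (m M : (Fin n → ℝ) → ℤ) :
    Prop where
  le : ∀ x, m x ≤ M x
  lower : ∀ x, ∀ᶠ y in 𝓝 x, m x ≤ m y
  upper : ∀ x, ∀ᶠ y in 𝓝 x, M y ≤ M x
  smul_lower : ∀ a : ℝ, a ≠ 0 → ∀ x, m (a • x) = m x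
  smul_upper : ∀ a : ℝ, a ≠ 0 → ∀ x, M (a • x) = M x
  decreasing : ∀ x, x ≠ 0 → M (S x) ≤ m x

namespace DiscreteLyapunov

variable {n : ℕ} {S S' : Module.End ℝ (Fin n → ℝ)} {m M : (Fin n → ℝ) → ℤ}

theorem injective_of_mul_eq_one (h : S' * S = 1) : Function.Injective S :=
  Function.LeftInverse.injective (g := S') fun z => by
    rw [← Module.End.mul_apply, h, Module.End.one_apply]

/-- Passing to the inverse operator exchanges the two functions up to sign. Each statement about
forward iterates thereby yields one about backward iterates. -/
theorem inv (hL : DiscreteLyapunov S m M) (h : S * S' = 1) :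
    DiscreteLyapunov S' (fun x => -M x) (fun x => -m x) where
  le x := neg_le_neg (hL.le x)
  lower x := (hL.upper x).mono fun _ => neg_le_neg
  upper x := (hL.lower x).mono fun _ => neg_le_neg
  smul_lower a ha x := congrArg Neg.neg (hL.smul_upper a ha x)
  smul_upper a ha x := congrArg Neg.neg (hL.smul_lower a ha x)
  decreasing x hx := by
    have h1 : S (S' x) = x := by rw [← Module.End.mul_apply, h, Module.End.one_apply]
    have h2 : S' x ≠ 0 := fun h0 => hx (by rw [← h1, h0, map_zero])
    have := hL.decreasing _ h2
    rw [h1] at this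
    exact neg_le_neg this

theorem upper_pow_le (hL : DiscreteLyapunov S m M) (hS : Function.Injective S) {x : Fin n → ℝ}
    (hx : x ≠ 0) (k : ℕ) : M ((S ^ (k + 1)) x) ≤ m x := by
  have hne : ∀ k, (S ^ k) x ≠ 0 := fun k h => hx (hS.iterate k (by
    rw [← Module.End.pow_apply, h, ← Module.End.pow_apply, map_zero]))
  induction k with
  | zero => simpa using hL.decreasing x hx
  | succ k ih =>
    rw [pow_succ', Module.End.mul_apply]
    exact (hL.decreasing _ (hne _)).trans ((hL.le _).trans ih)

/-- The lower function at a limit of scaled iterates is at most the lower function at the vector. -/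
theorem lower_limit_le (hL : DiscreteLyapunov S m M) (hS : Function.Injective S) {x y : Fin n → ℝ}
    (hx : x ≠ 0) {U : Ultrafilter ℕ} (hU : ↑U ≤ (atTop : Filter ℕ)) {a : ℕ → ℝ}
    (ha : ∀ᶠ k in U, a k ≠ 0) (h : Tendsto (fun k => a k • (S ^ k) x) U (𝓝 y)) : m y ≤ m x := by
  obtain ⟨k, ⟨h1, h2⟩, h3⟩ := ((ha.and (h.eventually (hL.lower y))).and
    ((eventually_ge_atTop 1).filter_mono hU)).exists
  obtain ⟨j, rfl⟩ := Nat.exists_eq_add_of_le' h3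
  rw [hL.smul_lower _ h1] at h2
  exact h2.trans ((hL.le _).trans (hL.upper_pow_le hS hx j))

/-- Recurrence closes the monotone chain. A scaled late iterate returns close to `S' x`, so lower
semicontinuity bounds `m (S' x)` by a value later on the orbit, which is at most `m x`; and `M x ≤ m
(S' x)`. -/
theorem upper_eq_lower (hL : DiscreteLyapunov S m M) (h : S * S' = 1) (h' : S' * S = 1) {r : ℝ}
    (hr : 0 < r) {x : Fin n → ℝ} (hx : x ∈ modulusEigenspace S r) (hx0 : x ≠ 0) : M x = m x := by
  have hS := injective_of_mul_eq_one h'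
  have h1 : S (S' x) = x := by rw [← Module.End.mul_apply, h, Module.End.one_apply]
  have h2 : S' x ≠ 0 := fun h0 => hx0 (by rw [← h1, h0, map_zero])
  have h3 : S' x ∈ modulusEigenspace S r := by
    have h4 := apply_mem_modulusEigenspace (modulusEigenspace_le_inv h' hr hx)
    have h5 := modulusEigenspace_le_inv h (inv_pos.2 hr) h4
    rwa [inv_inv] at h5
  refine le_antisymm ?_ (hL.le x)
  have h4 : M x ≤ m (S' x) := by
    have := hL.decreasing _ h2
    rwa [h1] at this
  refine h4.trans ?_
  obtain ⟨U, hU, hlim⟩ := exists_ultrafilter_recurrent_real hr h3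
  -- `k ≥ 2`, so that at least one `S` is left after cancelling against `S'`.
  obtain ⟨k, h5, h6⟩ := ((hlim.eventually (hL.lower _)).and
    ((eventually_ge_atTop 2).filter_mono hU)).exists
  obtain ⟨j, rfl⟩ := Nat.exists_eq_add_of_le' h6
  rw [hL.smul_lower _ (by positivity), show j + 2 = (j + 1) + 1 from rfl, pow_succ,
    Module.End.mul_apply, h1] at h5
  exact h5.trans ((hL.le _).trans (hL.upper_pow_le hS hx0 j))

/-- On this subspace `m = M` away from zero, so `m` is locally constant there. The line through `x`
and `y` is connected; if it passes through zero, `x` and `y` are proportional and scaling invariance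
applies. -/
theorem lower_eq_lower (hL : DiscreteLyapunov S m M) (h : S * S' = 1) (h' : S' * S = 1) {r : ℝ}
    (hr : 0 < r) {x y : Fin n → ℝ} (hx : x ∈ modulusEigenspace S r) (hx0 : x ≠ 0)
    (hy : y ∈ modulusEigenspace S r) (hy0 : y ≠ 0) : m x = m y := by
  by_cases hdep : ∃ t : ℝ, x + t • (y - x) = 0
  · obtain ⟨t, ht⟩ := hdep
    have ht0 : t ≠ 0 := by
      rintro rfl
      exact hx0 (by simpa using ht)
    have h1 : t • y = (t - 1) • x := by
      rw [smul_sub] at ht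
      rw [sub_smul, one_smul]
      exact sub_eq_zero.1 (by rw [← ht]; abel)
    have ht1 : t - 1 ≠ 0 := by
      intro h0
      rw [h0, zero_smul, smul_eq_zero] at h1
      exact h1.elim ht0 hy0
    rw [← hL.smul_lower t ht0 y, h1, hL.smul_lower _ ht1]
  · push Not at hdep
    have hcont : Continuous fun t : ℝ => m (x + t • (y - x)) := by
      refine continuous_iff_continuousAt.2 fun t => ?_
      have hc : Continuous fun t : ℝ => x + t • (y - x) := by fun_prop
      have hmem : x + t • (y - x) ∈ modulusEigenspace S r :=
        Submodule.add_mem _ hx (Submodule.smul_mem _ _ (Submodule.sub_mem _ hy hx))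
      have heq := hL.upper_eq_lower h h' hr hmem (hdep t)
      have hev : ∀ᶠ u in 𝓝 t, m (x + u • (y - x)) = m (x + t • (y - x)) := by
        filter_upwards [(hc.tendsto t).eventually (hL.lower _),
          (hc.tendsto t).eventually (hL.upper _)] with u hu1 hu2
        exact le_antisymm ((hL.le _).trans (hu2.trans heq.le)) hu1
      exact (continuousAt_const (y := m (x + t • (y - x)))).congr (hev.mono fun u hu => hu.symm)
    have := PreconnectedSpace.constant inferInstance hcont (x := 0) (y := 1)
    simpa using this

theorem exists_lower_le (hL : DiscreteLyapunov S m M) (hS : Function.Injective S) {Λ : Set ℂ}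
    {x : Fin n → ℝ} (hx : x ∈ spectralSubspace S Λ) (hx0 : x ≠ 0) :
    ∃ μ ∈ Λ, μ ≠ 0 ∧ ∃ y ∈ modulusEigenspace S ‖μ‖, y ≠ 0 ∧ m y ≤ m x := by
  obtain ⟨U, hU, a, ha, μ, hμ, hμ0, y, hy, hy0, hlim⟩ :=
    exists_ultrafilter_tendsto_modulusEigenspace hS hx hx0
  exact ⟨μ, hμ, hμ0, y, hy, hy0, hL.lower_limit_le hS hx0 hU ha hlim⟩

theorem exists_upper_ge (hL : DiscreteLyapunov S m M) (h : S * S' = 1) (h' : S' * S = 1)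
    {Λ : Set ℂ} {x : Fin n → ℝ} (hx : x ∈ spectralSubspace S Λ) (hx0 : x ≠ 0) :
    ∃ μ ∈ Λ, μ ≠ 0 ∧ ∃ y ∈ modulusEigenspace S ‖μ‖, y ≠ 0 ∧ M x ≤ M y := by
  obtain ⟨μ, hμ, hμ0, y, hy, hy0, hle⟩ := (hL.inv h).exists_lower_le (injective_of_mul_eq_one h)
    (spectralSubspace_le_inv h h' Λ hx) hx0
  refine ⟨μ⁻¹, hμ, inv_ne_zero hμ0, y, ?_, hy0, neg_le_neg_iff.1 hle⟩
  rw [norm_inv]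
  exact modulusEigenspace_le_inv h (norm_pos_iff.2 hμ0) hy

/-- Normalized by `R ^ k`, the iterates of `x` die out while those of `y` recur, so `y` is a limit
point of the normalized orbit of `x + y`. -/
theorem lower_le_lower_add (hL : DiscreteLyapunov S m M) (hS : Function.Injective S) {r R : ℝ}
    (hr : 0 < r) (hrR : r < R) {x y : Fin n → ℝ} (hx : x ∈ modulusEigenspace S r)
    (hy : y ∈ modulusEigenspace S R) (hy0 : y ≠ 0) : x + y ≠ 0 ∧ m y ≤ m (x + y) := by
  have hR : 0 < R := hr.trans hrR
  obtain ⟨U, hU, hlim⟩ := exists_ultrafilter_recurrent_real hR hy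
  have h1 : Tendsto (fun k : ℕ => ((R ^ k)⁻¹ : ℝ) • (S ^ k) (x + y)) U (𝓝 y) := by
    have := ((tendsto_pow_apply_zero_real hr hrR hx).mono_left hU).add hlim
    simpa [smul_add] using this
  have hne : x + y ≠ 0 := by
    intro h0
    simp only [h0, map_zero, smul_zero] at h1
    exact hy0 (tendsto_nhds_unique h1 tendsto_const_nhds)
  exact ⟨hne, hL.lower_limit_le hS hne hU
    (Eventually.of_forall fun k => inv_ne_zero (pow_ne_zero k hR.ne')) h1⟩

/-- On eigenvectors the Lyapunov function decreases as the modulus of the eigenvalue grows. -/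
theorem lower_le_upper_of_lt (hL : DiscreteLyapunov S m M) (h : S * S' = 1) (h' : S' * S = 1)
    {r R : ℝ} (hr : 0 < r) (hrR : r < R) {x y : Fin n → ℝ} (hx : x ∈ modulusEigenspace S r)
    (hx0 : x ≠ 0) (hy : y ∈ modulusEigenspace S R) (hy0 : y ≠ 0) : m y ≤ M x := by
  have hR : 0 < R := hr.trans hrR
  have h1 := (hL.lower_le_lower_add (injective_of_mul_eq_one h') hr hrR hx hy hy0).2
  -- For the inverse operator the roles are exchanged: `x` dominates, because `R⁻¹ < r⁻¹`. Both
  -- comparisons concern the same vector `x + y`.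
  have h2 := ((hL.inv h).lower_le_lower_add (injective_of_mul_eq_one h) (inv_pos.2 hR)
    ((inv_lt_inv₀ hR hr).2 hrR) (modulusEigenspace_le_inv h' hR hy)
    (modulusEigenspace_le_inv h' hr hx) hx0).2
  rw [neg_le_neg_iff, add_comm] at h2
  exact h1.trans ((hL.le _).trans h2)

end DiscreteLyapunov

/-! ### Characteristic values -/

section CharacteristicValues

open Module.End

/-- A complex root of the characteristic polynomial of a real operator has an eigenvector, written
here through its real and imaginary parts. -/
theorem exists_eigenvector_parts_of_isRoot_charpoly {V : Type*} [AddCommGroup V] [Module ℝ V]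
    [Module.Finite ℝ V] (R : V →ₗ[ℝ] V) {z : ℂ}
    (hz : (R.charpoly.map (algebraMap ℝ ℂ)).IsRoot z) :
    ∃ p q : V, (p ≠ 0 ∨ q ≠ 0) ∧ R p = z.re • p - z.im • q ∧ R q = z.im • p + z.re • q := by
  set b := Module.finBasis ℝ V
  set B := LinearMap.toMatrix b b R with hB
  rw [← LinearMap.charpoly_toMatrix R b, ← Matrix.charpoly_map, Polynomial.IsRoot.def,
    Matrix.eval_charpoly] at hz
  obtain ⟨v, hv0, hv⟩ := Matrix.exists_mulVec_eq_zero_iff.2 hz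
  have hentry : ∀ i, ∑ j, ((B i j : ℝ) : ℂ) * v j = z * v i := by
    intro i
    have := congrFun hv i
    rw [Matrix.sub_mulVec, Pi.sub_apply, Pi.zero_apply, sub_eq_zero] at this
    rw [Matrix.scalar_apply, Matrix.mulVec_diagonal] at this
    rw [this, hB]
    simp [Matrix.mulVec, dotProduct]
  have happ : ∀ w : Fin (Module.finrank ℝ V) → ℝ,
      R (b.equivFun.symm w) = b.equivFun.symm (B.mulVec w) := by
    intro w
    rw [LinearEquiv.eq_symm_apply, Module.Basis.equivFun_apply, ← LinearMap.toMatrix_mulVec_repr b b,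
      ← Module.Basis.equivFun_apply, LinearEquiv.apply_symm_apply]
  refine ⟨b.equivFun.symm fun i => (v i).re, b.equivFun.symm fun i => (v i).im, ?_, ?_, ?_⟩
  · by_contra hcon
    push Not at hcon
    refine hv0 (funext fun i => Complex.ext ?_ ?_)
    · exact congrFun ((LinearEquiv.map_eq_zero_iff _).1 hcon.1) i
    · exact congrFun ((LinearEquiv.map_eq_zero_iff _).1 hcon.2) i
  · rw [happ, ← map_smul, ← map_smul, ← map_sub]
    congr 1
    ext i
    have := congrArg Complex.re (hentry i)
    simpa [Matrix.mulVec, dotProduct] using this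
  · rw [happ, ← map_smul, ← map_smul, ← map_add]
    congr 1
    ext i
    have := congrArg Complex.im (hentry i)
    simpa [Matrix.mulVec, dotProduct, add_comm] using this

theorem exists_mem_modulusEigenspace_ne_zero {n : ℕ} {S : Module.End ℝ (Fin n → ℝ)} {μ : ℂ}
    {z : Fin n → ℂ} (hz : z ∈ eigenspace (complexify S) μ) (hz0 : z ≠ 0) :
    ∃ x ∈ modulusEigenspace S ‖μ‖, x ≠ 0 := by
  have hz' : z ∈ ⨆ ν ∈ {ν : ℂ | ‖ν‖ = ‖μ‖}, eigenspace (complexify S) ν :=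
    Submodule.mem_iSup_of_mem μ (Submodule.mem_iSup_of_mem rfl hz)
  have h := realToComplex_rePart_mem (fun ν w hw => star_mem_eigenspace hw)
    (fun ν (hν : ‖ν‖ = ‖μ‖) => show ‖star ν‖ = ‖μ‖ by rw [norm_star, hν]) hz'
  by_cases h0 : rePart n z = 0
  · refine ⟨imPart n z, h.2, fun h1 => hz0 ?_⟩
    exact complexVector_ext (by rw [h0, map_zero]) (by rw [h1, map_zero])
  · exact ⟨rePart n z, h.1, h0⟩

/-- The characteristic values of the restriction of an operator to an invariant subspace of a
spectral subspace. -/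
theorem exists_eigenvector_of_isRoot_charpoly_restrict {n : ℕ} {S : (Fin n → ℝ) →ₗ[ℝ] (Fin n → ℝ)}
    {Λ : Set ℂ} {W : Submodule ℝ (Fin n → ℝ)} (hWΛ : W ≤ spectralSubspace S Λ)
    (hW : ∀ x ∈ W, S x ∈ W) {z : ℂ}
    (hz : ((S.restrict hW).charpoly.map (algebraMap ℝ ℂ)).IsRoot z) : z ∈ Λ := by
  obtain ⟨p, q, hpq, hp, hq⟩ := exists_eigenvector_parts_of_isRoot_charpoly _ hz
  have hp' : S p = z.re • (p : Fin n → ℝ) - z.im • (q : Fin n → ℝ) := congrArg Subtype.val hp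
  have hq' : S q = z.im • (p : Fin n → ℝ) + z.re • (q : Fin n → ℝ) := congrArg Subtype.val hq
  set w : Fin n → ℂ := realToComplex n p + Complex.I • realToComplex n q with hw
  have hre : rePart n w = p := by
    ext i
    simp [hw, rePart, realToComplex]
  have him : imPart n w = q := by
    ext i
    simp [hw, imPart, realToComplex]
  have hw0 : w ≠ 0 := by
    intro h0
    rw [h0, map_zero] at hre him
    rcases hpq with h | h
    · exact h (Subtype.ext hre.symm)
    · exact h (Subtype.ext him.symm)
  have heig : w ∈ eigenspace (complexify S) z := by
    rw [mem_eigenspace_iff]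
    refine complexVector_ext ?_ ?_
    · rw [rePart_complexify, hre, hp', ← hre, ← him]
      ext i
      simp [rePart, imPart]
    · rw [imPart_complexify, him, hq', ← hre, ← him]
      ext i
      simp [rePart, imPart, add_comm]
  have hmem : w ∈ ⨆ μ ∈ Λ, maxGenEigenspace (complexify S) μ :=
    Submodule.add_mem _ (hWΛ p.2) (Submodule.smul_mem _ _ (hWΛ q.2))
  -- Were `z` outside `Λ`, independence of the generalized eigenspaces would force its eigenvector
  -- `w` to vanish.
  by_contra hzΛ
  exact hw0 (Submodule.disjoint_def.1
    ((independent_maxGenEigenspace (complexify S)).disjoint_biSup hzΛ) w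
    ((genEigenspace (complexify S) z).mono le_top heig) hmem)

theorem spectralModuli_finite {V : Type*} [AddCommGroup V] [Module ℝ V] [Module.Finite ℝ V]
    (T : V →ₗ[ℝ] V) : (spectralModuli T).Finite := by
  have h0 : T.charpoly.map (algebraMap ℝ ℂ) ≠ 0 := (T.charpoly_monic.map _).ne_zero
  exact (Polynomial.finite_setOfPred_isRoot h0).image fun z : ℂ => ‖z‖

theorem spectralModuli_nonempty {V : Type*} [AddCommGroup V] [Module ℝ V] [Module.Finite ℝ V]
    (T : V →ₗ[ℝ] V) (hV : Module.finrank ℝ V ≠ 0) : (spectralModuli T).Nonempty := by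
  have hdeg : (T.charpoly.map (algebraMap ℝ ℂ)).degree ≠ 0 := by
    rw [Polynomial.degree_map, Polynomial.degree_eq_natDegree T.charpoly_monic.ne_zero,
      LinearMap.charpoly_natDegree]
    exact_mod_cast hV
  obtain ⟨z, hz⟩ := IsAlgClosed.exists_root _ hdeg
  exact ⟨‖z‖, z, hz, rfl⟩

end CharacteristicValues

/-! ### Dimensions -/

/-- Reading off two adjacent coordinates is injective on `W`, because a kernel vector would have two
adjacent zeros. -/
theorem finrank_le_two_of_subset_lyapDomain {n : ℕ} (hn : 3 ≤ n) {W : Submodule ℝ (Fin n → ℝ)}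
    (hW : ∀ x ∈ W, x ≠ 0 → x ∈ lyapDomain n) : Module.finrank ℝ W ≤ 2 := by
  let i : Fin n := ⟨0, by omega⟩
  let f : (Fin n → ℝ) →ₗ[ℝ] (ℝ × ℝ) := (LinearMap.proj i).prod (LinearMap.proj (finRotate n i))
  have hinj : Function.Injective (f.comp W.subtype) := by
    refine (injective_iff_map_eq_zero _).2 fun x hx => ?_
    by_contra h0
    have h1 : (x : Fin n → ℝ) i = 0 := congrArg Prod.fst hx
    have h2 : (x : Fin n → ℝ) (finRotate n i) = 0 := congrArg Prod.snd hx
    exact not_adjacent_zeros hn (hW x x.2 fun h => h0 (Subtype.ext h)) h1 h2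
  simpa using LinearMap.finrank_le_finrank_of_injective hinj

theorem finrank_le_one_of_lyapMin_eq {n : ℕ} (hn : 2 ≤ n) {W : Submodule ℝ (Fin n → ℝ)}
    (hW : ∀ x ∈ W, x ≠ 0 → x ∈ lyapDomain n ∧ lyapMin x = n) : Module.finrank ℝ W ≤ 1 := by
  let i : Fin n := ⟨0, by omega⟩
  let f : (Fin n → ℝ) →ₗ[ℝ] ℝ := LinearMap.proj i
  have hinj : Function.Injective (f.comp W.subtype) := by
    refine (injective_iff_map_eq_zero _).2 fun x hx => ?_
    by_contra h0
    have h1 := hW x x.2 fun h => h0 (Subtype.ext h)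
    exact ne_zero_of_lyapMin_eq hn h1.1 h1.2 i hx
  simpa using LinearMap.finrank_le_finrank_of_injective hinj

theorem sum_floquetDim {n : ℕ} (hn : 3 ≤ n) : ∑ i : Fin ((oddFloor n + 1) / 2),
    (if (i : ℕ) < (oddFloor n - 1) / 2 then 2 else if Odd n then 1 else 2) = n := by
  rw [Fin.sum_univ_eq_sum_range (fun i => if i < (oddFloor n - 1) / 2 then 2 else
    if Odd n then 1 else 2)]
  have h1 : (oddFloor n + 1) / 2 = (oddFloor n - 1) / 2 + 1 := by
    unfold oddFloor
    split_ifs <;> omega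
  rw [h1, Finset.sum_range_succ, Finset.sum_congr rfl fun i hi => if_pos (Finset.mem_range.1 hi),
    Finset.sum_const, Finset.card_range, if_neg (lt_irrefl _), smul_eq_mul]
  unfold oddFloor
  split_ifs with h
  · obtain ⟨k, rfl⟩ := h
    omega
  · rw [Nat.not_odd_iff_even] at h
    obtain ⟨k, rfl⟩ := h
    omega

theorem DirectSum.IsInternal.sum_finrank {K V ι : Type*} [Field K] [AddCommGroup V] [Module K V]
    [FiniteDimensional K V] [Fintype ι] [DecidableEq ι] {W : ι → Submodule K V}
    (h : DirectSum.IsInternal W) : ∑ i, Module.finrank K (W i) = Module.finrank K V := by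
  rw [← Module.finrank_directSum]
  exact (LinearEquiv.ofBijective (DirectSum.coeLinearMap W) h).finrank_eq

/-! ### The Floquet decomposition -/

theorem discreteLyapunov_of_lyapMax_le_lyapMin {n : ℕ} {S : (Fin n → ℝ) →ₗ[ℝ] (Fin n → ℝ)}
    (h : ∀ x, x ≠ 0 → lyapMax (S x) ≤ lyapMin x) :
    DiscreteLyapunov S (fun x => (lyapMin x : ℤ)) (fun x => (lyapMax x : ℤ)) where
  le x := by exact_mod_cast lyapMin_le_lyapMax x
  lower x := (eventually_lyapMin_le x).mono fun y hy => by exact_mod_cast hy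
  upper x := (eventually_lyapMax_le x).mono fun y hy => by exact_mod_cast hy
  smul_lower a ha x := by rw [lyapMin_smul ha]
  smul_upper a ha x := by rw [lyapMax_smul ha]
  decreasing x hx := by exact_mod_cast h x hx

/-- The complex numbers `μ` such that the eigenvectors to eigenvalues of modulus `‖μ‖` have `c`
sign changes. -/
def spectralClass {n : ℕ} (S : Module.End ℝ (Fin n → ℝ)) (c : ℕ) : Set ℂ :=
  {μ | μ ≠ 0 ∧ ∃ x ∈ modulusEigenspace S ‖μ‖, x ≠ 0 ∧ lyapMin x = c}

section Floquet

open Module.End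

variable {n : ℕ} {S S' : Module.End ℝ (Fin n → ℝ)}

theorem lyapMin_eq_of_mem_spectralClass (h : S * S' = 1) (h' : S' * S = 1)
    (hL : ∀ x, x ≠ 0 → lyapMax (S x) ≤ lyapMin x) {c : ℕ} {μ : ℂ} (hμ : μ ∈ spectralClass S c)
    {y : Fin n → ℝ} (hy : y ∈ modulusEigenspace S ‖μ‖) (hy0 : y ≠ 0) :
    lyapMin y = c ∧ lyapMax y = c := by
  obtain ⟨hμ0, x, hx, hx0, rfl⟩ := hμ
  have hD := discreteLyapunov_of_lyapMax_le_lyapMin hL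
  have h1 := hD.lower_eq_lower h h' (norm_pos_iff.2 hμ0) hx hx0 hy hy0
  have h2 := hD.upper_eq_lower h h' (norm_pos_iff.2 hμ0) hy hy0
  constructor
  · exact_mod_cast h1.symm
  · exact_mod_cast h2.trans h1.symm

theorem eq_of_mem_spectralClass (h : S * S' = 1) (h' : S' * S = 1)
    (hL : ∀ x, x ≠ 0 → lyapMax (S x) ≤ lyapMin x) {c d : ℕ} {μ : ℂ} (hc : μ ∈ spectralClass S c)
    (hd : μ ∈ spectralClass S d) : c = d := by
  obtain ⟨-, x, hx, hx0, rfl⟩ := hc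
  exact (lyapMin_eq_of_mem_spectralClass h h' hL hd hx hx0).1

/-- Equal moduli would share one eigenspace and hence one value of `N`; the opposite strict order
contradicts the monotonicity of `N` in the modulus. -/
theorem norm_lt_of_mem_spectralClass (h : S * S' = 1) (h' : S' * S = 1)
    (hL : ∀ x, x ≠ 0 → lyapMax (S x) ≤ lyapMin x) {c d : ℕ} (hcd : c < d) {μ ν : ℂ}
    (hμ : μ ∈ spectralClass S c) (hν : ν ∈ spectralClass S d) : ‖ν‖ < ‖μ‖ := by
  by_contra hcon
  obtain ⟨hν0, y, hy, hy0, hyd⟩ := id hν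
  obtain ⟨hμ0, x, hx, hx0, hxc⟩ := id hμ
  rcases (not_lt.1 hcon).eq_or_lt with heq | hlt
  · rw [← heq] at hy
    have := (lyapMin_eq_of_mem_spectralClass h h' hL hμ hy hy0).1
    omega
  · have h1 := (discreteLyapunov_of_lyapMax_le_lyapMin hL).lower_le_upper_of_lt h h'
      (norm_pos_iff.2 hμ0) hlt hx hx0 hy hy0
    have h2 := (lyapMin_eq_of_mem_spectralClass h h' hL hμ hx hx0).2
    have h3 : lyapMin y ≤ lyapMax x := by exact_mod_cast h1
    omega

/-- The two bounds come from limits of normalized forward and backward iterates. Each limit lies in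
a modulus eigenspace belonging to one of the classes in `C`, where `N` is known exactly. -/
theorem exists_le_lyapMin_of_mem_spectralSubspace (h : S * S' = 1) (h' : S' * S = 1)
    (hL : ∀ x, x ≠ 0 → lyapMax (S x) ≤ lyapMin x) {C : Set ℕ} {x : Fin n → ℝ}
    (hx : x ∈ spectralSubspace S (⋃ c ∈ C, spectralClass S c)) (hx0 : x ≠ 0) :
    (∃ c ∈ C, c ≤ lyapMin x) ∧ ∃ c ∈ C, lyapMax x ≤ c := by
  have hD := discreteLyapunov_of_lyapMax_le_lyapMin hL
  constructor
  · obtain ⟨μ, hμ, -, y, hy, hy0, hle⟩ :=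
      hD.exists_lower_le (DiscreteLyapunov.injective_of_mul_eq_one h') hx hx0
    obtain ⟨c, hc, hμc⟩ := mem_iUnion₂.1 hμ
    refine ⟨c, hc, ?_⟩
    rw [← (lyapMin_eq_of_mem_spectralClass h h' hL hμc hy hy0).1]
    exact_mod_cast hle
  · obtain ⟨μ, hμ, -, y, hy, hy0, hle⟩ := hD.exists_upper_ge h h' hx hx0
    obtain ⟨c, hc, hμc⟩ := mem_iUnion₂.1 hμ
    refine ⟨c, hc, ?_⟩
    rw [← (lyapMin_eq_of_mem_spectralClass h h' hL hμc hy hy0).2]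
    exact_mod_cast hle

theorem spectralSubspace_mono {Λ Λ' : Set ℂ} (h : Λ ⊆ Λ') :
    spectralSubspace S Λ ≤ spectralSubspace S Λ' := fun _ hx =>
  (biSup_mono h : (⨆ μ ∈ Λ, maxGenEigenspace (complexify S) μ) ≤ _) hx

theorem iSupIndep_spectralSubspace {ι : Type*} {Λ : ι → Set ℂ}
    (h : ∀ i j, i ≠ j → Disjoint (Λ i) (Λ j)) :
    iSupIndep fun i => spectralSubspace S (Λ i) := by
  intro i
  refine Submodule.disjoint_def.2 fun x hx hx' => ?_
  have h1 : (⨆ (j) (_ : j ≠ i), spectralSubspace S (Λ j)) ≤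
      spectralSubspace S (⋃ (j) (_ : j ≠ i), Λ j) :=
    iSup₂_le fun j hj => spectralSubspace_mono (subset_iUnion₂ (s := fun j (_ : j ≠ i) => Λ j) j hj)
  have h2 : Disjoint (Λ i) (⋃ (j) (_ : j ≠ i), Λ j) :=
    disjoint_iUnion₂_right.2 fun j hj => h i j hj.symm
  have h3 := (independent_maxGenEigenspace (complexify S)).disjoint_biSup_biSup h2
  refine realToComplex_injective n ?_
  rw [map_zero]
  exact Submodule.disjoint_def.1 h3 _ hx (h1 hx')

/-- Each nonzero component of a vector belongs to a genuine eigenvalue, whose modulus carries an odd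
value of `N` at most `n`. Its real part stays in the same class, since membership depends only on
the modulus. -/
theorem iSup_spectralSubspace_spectralClass (hn : 1 ≤ n) (hS : Function.Injective S) :
    ⨆ i : Fin ((oddFloor n + 1) / 2), spectralSubspace S (spectralClass S (2 * (i : ℕ) + 1)) = ⊤ := by
  refine (Submodule.eq_top_iff').2 fun x => ?_
  have htop : realToComplex n x ∈ ⨆ μ ∈ (univ : Set ℂ), maxGenEigenspace (complexify S) μ := by
    simp [iSup_maxGenEigenspace_eq_top]
  obtain ⟨s, -, f, hf, hsum⟩ := Submodule.exists_finset_sum_of_mem_biSup htop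
  rw [← rePart_realToComplex x, ← hsum, map_sum]
  refine Submodule.sum_mem _ fun μ hμ => ?_
  obtain ⟨hfμ, hf0⟩ := hf μ hμ
  have hμ0 := ne_zero_of_mem_maxGenEigenspace (complexify_injective hS) hfμ hf0
  have hev : (complexify S).HasEigenvalue μ := by
    have h1 : (complexify S).HasUnifEigenvalue μ ⊤ := fun h0 => hf0 (by
      have : f μ ∈ (complexify S).genEigenspace μ ⊤ := hfμ
      rwa [h0, Submodule.mem_bot] at this)
    exact h1.lt zero_lt_one
  obtain ⟨z, hz⟩ := hev.exists_hasEigenvector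
  obtain ⟨y, hy, hy0⟩ := exists_mem_modulusEigenspace_ne_zero hz.1 hz.2
  obtain ⟨i, hi⟩ := odd_of_mem_nearbyValues hn (lyapMin_mem y)
  have hle := le_of_mem_nearbyValues (lyapMin_mem y)
  have hlt : i < (oddFloor n + 1) / 2 := by
    unfold oddFloor
    split_ifs with hodd
    · omega
    · rw [Nat.not_odd_iff_even] at hodd
      obtain ⟨k, rfl⟩ := hodd
      omega
  have hclass : μ ∈ spectralClass S (2 * i + 1) := ⟨hμ0, y, hy, hy0, hi⟩
  refine Submodule.mem_iSup_of_mem ⟨i, hlt⟩ ?_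
  have hconj : ∀ ν ∈ spectralClass S (2 * i + 1), star ν ∈ spectralClass S (2 * i + 1) :=
    fun ν hν => ⟨star_ne_zero.2 hν.1, by rw [norm_star]; exact hν.2⟩
  exact (realToComplex_rePart_mem (p := maxGenEigenspace (complexify S))
    (fun ν w hw => star_mem_maxGenEigenspace hw) hconj
    (Submodule.mem_iSup_of_mem μ (Submodule.mem_iSup_of_mem hclass hfμ))).1

end Floquet

/-- The subspaces `W` and the numbers `μ`, `ν` are indexed from `0`, so that the value `2 i - 1`
of the usual numbering from `1` reads `2 * i + 1`. -/
theorem theorem3p1 (n : ℕ) (hn : 3 ≤ n) (α β : EReal) (A : ℝ → Matrix (Fin n) (Fin n) ℝ)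
    (hcont : ContinuousOn A (realIoo α β)) (hA : ∀ τ ∈ realIoo α β, A τ ∈ MMinus n)
    (s t : ℝ) (hs : s ∈ realIoo α β) (ht : t ∈ realIoo α β) (hst : s < t) :
    ∃ S : (Fin n → ℝ) →ₗ[ℝ] (Fin n → ℝ), IsSolutionOperator α β A s t S ∧
    ∃ W : Fin ((oddFloor n + 1) / 2) → Submodule ℝ (Fin n → ℝ),
    ∃ hW : ∀ i, ∀ x ∈ W i, S x ∈ W i,
      (∀ i, Module.finrank ℝ (W i) =
        if (i : ℕ) < (oddFloor n - 1) / 2 then 2 else if Odd n then 1 else 2) ∧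
      DirectSum.IsInternal W ∧
      (∀ i, ∀ x ∈ W i, x ≠ 0 → x ∈ lyapDomain n ∧ lyapN x = 2 * (i : ℕ) + 1) ∧
      (∀ i k, i ≤ k → ∀ x ∈ ⨆ j ∈ Set.Icc i k, W j, x ≠ 0 →
        2 * (i : ℕ) + 1 ≤ lyapMin x ∧ lyapMax x ≤ 2 * (k : ℕ) + 1) ∧
      ∃ μ ν : Fin ((oddFloor n + 1) / 2) → ℝ,
        (∀ i, IsGreatest (spectralModuli (S.restrict (hW i))) (μ i)) ∧
        (∀ i, IsLeast (spectralModuli (S.restrict (hW i))) (ν i)) ∧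
        (∀ i, ν i ≤ μ i) ∧
        (∀ i j, i < j → μ j < ν i) := by
  obtain ⟨S, hS⟩ := exists_isSolutionOperator hcont hs ht
  obtain ⟨S', hS'⟩ := exists_isSolutionOperator hcont ht hs
  have h : (S * S' : Module.End ℝ (Fin n → ℝ)) = 1 := LinearMap.ext (hS'.symm_apply hS)
  have h' : (S' * S : Module.End ℝ (Fin n → ℝ)) = 1 := LinearMap.ext (hS.symm_apply hS')
  have hL : ∀ x, x ≠ 0 → lyapMax (S x) ≤ lyapMin x := fun x hx =>
    lyapMax_le_lyapMin_of_isSolutionOperator hn hcont hA hs ht hst hS hx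
  set W : Fin ((oddFloor n + 1) / 2) → Submodule ℝ (Fin n → ℝ) := fun i =>
    spectralSubspace S (spectralClass S (2 * (i : ℕ) + 1)) with hWdef
  have hWinv : ∀ i, ∀ x ∈ W i, S x ∈ W i := fun i x hx => apply_mem_spectralSubspace hx
  have hint : DirectSum.IsInternal W := by
    refine DirectSum.isInternal_submodule_of_iSupIndep_of_iSup_eq_top
      (iSupIndep_spectralSubspace fun i j hij => Set.disjoint_left.2 fun μ hi hj => hij ?_)
      (iSup_spectralSubspace_spectralClass (by omega) (DiscreteLyapunov.injective_of_mul_eq_one h'))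
    have := eq_of_mem_spectralClass h h' hL hi hj
    exact Fin.ext (by omega)
  have hbounds : ∀ i k, i ≤ k → ∀ x ∈ ⨆ j ∈ Set.Icc i k, W j, x ≠ 0 →
      2 * (i : ℕ) + 1 ≤ lyapMin x ∧ lyapMax x ≤ 2 * (k : ℕ) + 1 := by
    intro i k _ x hx hx0
    have hx' : x ∈ spectralSubspace S
        (⋃ c ∈ Set.Icc (2 * (i : ℕ) + 1) (2 * (k : ℕ) + 1), spectralClass S c) := by
      refine (iSup₂_le fun j hj => spectralSubspace_mono ?_ : (⨆ j ∈ Set.Icc i k, W j) ≤ _) hx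
      have h1 : (i : ℕ) ≤ j := hj.1
      have h2 : (j : ℕ) ≤ k := hj.2
      exact Set.subset_biUnion_of_mem (u := spectralClass S)
        (show 2 * (j : ℕ) + 1 ∈ Set.Icc (2 * (i : ℕ) + 1) (2 * (k : ℕ) + 1) from
          ⟨by omega, by omega⟩)
    obtain ⟨⟨c, hc, h1⟩, d, hd, h2⟩ := exists_le_lyapMin_of_mem_spectralSubspace h h' hL hx' hx0
    exact ⟨hc.1.trans h1, h2.trans hd.2⟩
  have hvalue : ∀ i, ∀ x ∈ W i, x ≠ 0 → x ∈ lyapDomain n ∧ lyapN x = 2 * (i : ℕ) + 1 := by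
    intro i x hx hx0
    have h1 := hbounds i i le_rfl x (by simpa using hx) hx0
    have h2 := lyapMin_le_lyapMax x
    have h3 : lyapMin x = 2 * (i : ℕ) + 1 := by omega
    have h4 : lyapMin x = lyapMax x := by omega
    exact ⟨h4, h3⟩
  have hdim : ∀ i, Module.finrank ℝ (W i) =
      if (i : ℕ) < (oddFloor n - 1) / 2 then 2 else if Odd n then 1 else 2 := by
    have hle : ∀ i ∈ (Finset.univ : Finset (Fin ((oddFloor n + 1) / 2))),
        Module.finrank ℝ (W i) ≤
          if (i : ℕ) < (oddFloor n - 1) / 2 then 2 else if Odd n then 1 else 2 := by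
      intro i _
      have h2 := finrank_le_two_of_subset_lyapDomain hn fun x hx hx0 => (hvalue i x hx hx0).1
      split_ifs with h3 h4
      · exact h2
      · refine finrank_le_one_of_lyapMin_eq (by omega) fun x hx hx0 =>
          ⟨(hvalue i x hx hx0).1, (hvalue i x hx hx0).2.trans ?_⟩
        have h5 := i.isLt
        have h6 : oddFloor n = n := if_pos h4
        obtain ⟨k, hk⟩ := h4
        omega
      · exact h2
    -- Both the dimensions and their upper bounds sum to `n`, so every bound is attained.
    have hsum := (Finset.sum_eq_sum_iff_of_le hle).1 (by
      rw [hint.sum_finrank, sum_floquetDim hn, Module.finrank_fin_fun])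
    exact fun i => hsum i (Finset.mem_univ i)
  have hne : ∀ i, (spectralModuli (S.restrict (hWinv i))).Nonempty := fun i =>
    spectralModuli_nonempty _ (by rw [hdim i]; split_ifs <;> norm_num)
  choose μ hμ using fun i =>
    (spectralModuli_finite (S.restrict (hWinv i))).isCompact.exists_isGreatest (hne i)
  choose ν hν using fun i =>
    (spectralModuli_finite (S.restrict (hWinv i))).isCompact.exists_isLeast (hne i)
  refine ⟨S, hS, W, hWinv, hdim, hint, hvalue, hbounds, μ, ν, hμ, hν, fun i => (hν i).2 (hμ i).1,
    fun i j hij => ?_⟩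
  obtain ⟨z, hz, hzμ⟩ := (hμ j).1
  obtain ⟨w, hw, hwν⟩ := (hν i).1
  rw [← hzμ, ← hwν]
  have hij' : (i : ℕ) < j := hij
  exact norm_lt_of_mem_spectralClass h h' hL (by omega : 2 * (i : ℕ) + 1 < 2 * (j : ℕ) + 1)
    (exists_eigenvector_of_isRoot_charpoly_restrict le_rfl (hWinv i) hw)
    (exists_eigenvector_of_isRoot_charpoly_restrict le_rfl (hWinv j) hz)
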